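/- Let $T>0$, $\alpha\ge 0$, $L\in\{1,2,\dots\}\cup\{\infty\}$, and write $[n]=\{1,\dots,n\}$, $[\infty]=\{1,2,\dots\}$. The $(L,\alpha)$-one-cold Poisson channel (OCPC) of duration $T$ takes as input a measurable function $x:[0,T]\to[L]$ and outputs counting processes $(Y_i(t))_{t\in[0,T]}$, $i\in[L]$, which are independent across $i$, where $Y_i$ is a Poisson process with intensity function $t\mapsto 1-(1-\alpha)\mathbf 1\{x(t)=i\}$. The perfect OCPC is the case $L=\infty$, $\alpha=0$. A code for $M$ messages consists of a measurable input $x(k,\cdot):[0,T]\to[L]$ for each $k\in[M]$ and of a measurable decoder that maps the output to $[M]$. Let $M^*(L,\alpha,T,\epsilon)$ be the largest number $M\ge 1$ of messages ($\infty$ if there is no bound) for which some code has average error probability at most $\epsilon$ for a uniformly distributed message, and let $\epsilon^*(L,\alpha,T,M)=\inf\{\epsilon\ge 0: M^*(L,\alpha,T,\epsilon)\ge M\}$. Theorem. Let $M\ge1$ be an integer with $L\ge M$. Let $Z_1\sim\mathrm{Poi}(\alpha T)$ and $Z_i\sim\mathrm{Poi}(T)$, $i=2,\dots,M$, be independent.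 If $\alpha\in[0,1]$, then $$\epsilon^*(L,\alpha,T,M)=\mathbb P(\hat K\ne 1),$$ where, conditionally on $(Z_i)_{i\in[M]}$, $\hat K$ is uniformly distributed over $\operatorname{argmin}_{i\in[M]}Z_i$. If $\alpha>1$, the same holds with $\operatorname{argmax}$ in place of $\operatorname{argmin}$. In both cases the optimum is attained by sending each message in its own band: for every injective $f:[M]\to[L]$, the inputs $x(k,t)=f(k)$, with a suitable decoder, have average error probability exactly $\epsilon^*(L,\alpha,T,M)$. In particular, for the perfect OCPC, $$\epsilon^*(\infty,0,T,M)=1-e^{T}M^{-1}\bigl(1-(1-e^{-T})^{M}\bigr)\qquad\text{for every integer } M\ge 1.$$ -/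

import Mathlib

open MeasureTheory ProbabilityTheory
open scoped NNReal ENNReal

namespace OCPC

/-- The index set of the bands: `{0, …, L - 1}` if `L` is finite, all of `ℕ` if `L = ∞`
(bands and messages are numbered from `0`). -/
abbrev Band (L : ℕ∞) : Type := {i : ℕ // (i : ℕ∞) < L}

/-- The time interval `[0, T]`. -/
abbrev Time (T : ℝ≥0) : Type := Set.Icc (0 : ℝ) (T : ℝ)

/-- The time `0`, as a point of `[0, T]`. -/
def Time.start (T : ℝ≥0) : Time T := ⟨0, le_refl 0, T.2⟩

/-- Paths of counting processes on `[0, T]`: nondecreasing right-continuous functions with values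
in `ℕ` that start at `0`. It carries the sigma-algebra generated by the evaluations. -/
abbrev CountingPath (T : ℝ≥0) : Type :=
  {y : Time T → ℕ //
    y (Time.start T) = 0 ∧ Monotone y ∧ ∀ t, ContinuousWithinAt y (Set.Ici t) t}

/-- The channel output: one counting path for each band (with the product sigma-algebra). -/
abbrev Output (L : ℕ∞) (T : ℝ≥0) : Type := Band L → CountingPath T

/-- The intensity `1 - (1 - α) 1{x(τ) = i}` of the process of band `i` at time `τ`, if the input
is `x`. -/
noncomputable def intensity {L : ℕ∞} {T : ℝ≥0} (α : ℝ≥0) (x : Time T → Band L) (i : Band L)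
    (τ : Time T) : ℝ :=
  1 - (1 - (α : ℝ)) * (if x τ = i then 1 else 0)

/-- `P` is the law of the output of the one-cold Poisson channel with `L` bands, leakage `α` and
duration `T` for the input `x`: under `P`, the bands are independent, and the output of band `i`
is a Poisson process with intensity function `intensity α x i`, that is, it has independent
increments, and its increment over `(t₀, t₁]` is Poisson with parameter the integral of the intensity over
that interval, for Lebesgue measure. -/
structure IsOutputLaw {L : ℕ∞} {T : ℝ≥0} (α : ℝ≥0) (x : Time T → Band L)
    (P : Measure (Output L T)) : Prop where
  isProbabilityMeasure : IsProbabilityMeasure P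
  indep_bands : iIndepFun (fun (i : Band L) (y : Output L T) => y i) P
  indep_increments : ∀ i : Band L,
    HasIndepIncrements (fun (t : Time T) (y : Output L T) => (y i).1 t) P
  law_increment : ∀ (i : Band L) (t₀ t₁ : Time T), t₀ < t₁ →
    HasLaw (fun y : Output L T => (y i).1 t₁ - (y i).1 t₀)
      (poissonMeasure (∫ τ in Set.Ioc t₀ t₁, intensity α x i τ
        ∂(Measure.comap Subtype.val volume : Measure (Time T))).toNNReal) P

/-- A coding scheme for `M` messages: a channel input for each message, and a decoder. -/
structure Code (L : ℕ∞) (T : ℝ≥0) (M : ℕ) where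
  enc : Fin M → Time T → Band L
  measurable_enc : ∀ k, Measurable (enc k)
  dec : Output L T → Fin M
  measurable_dec : Measurable dec

/-- `e` is the average error probability of the code `c` over the channel, for a message that is
uniformly distributed over the `M` possible values. -/
def Code.HasErrorProb {L : ℕ∞} {T : ℝ≥0} {M : ℕ} (c : Code L T M) (α : ℝ≥0) (e : ℝ) : Prop :=
  ∃ P : Fin M → Measure (Output L T), (∀ k, IsOutputLaw α (c.enc k) (P k)) ∧
    e = (∑ k, (P k).real {y | c.dec y ≠ k}) / M

/-- The largest number of messages (`∞` if there is no bound) that can be sent with average error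
probability at most `ε`. -/
noncomputable def maxMessages (L : ℕ∞) (α T : ℝ≥0) (ε : ℝ) : ℕ∞ :=
  sSup {m : ℕ∞ | ∃ M : ℕ, 1 ≤ M ∧ m = M ∧
    ∃ (c : Code L T M) (e : ℝ), c.HasErrorProb α e ∧ e ≤ ε}

/-- The optimal error probability for `M` messages. -/
noncomputable def optError (L : ℕ∞) (α T : ℝ≥0) (M : ℕ) : ℝ :=
  sInf {ε : ℝ | 0 ≤ ε ∧ (M : ℕ∞) ≤ maxMessages L α T ε}

/-- The set of the indices where `z` is smallest. -/
def argminSet {M : ℕ} (z : Fin M → ℕ) : Set (Fin M) := {k | ∀ j, z k ≤ z j}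

/-- The set of the indices where `z` is largest. -/
def argmaxSet {M : ℕ} (z : Fin M → ℕ) : Set (Fin M) := {k | ∀ j, z j ≤ z k}

/-- The law of independent Poisson variables `Z i`, where the one with index `0` has mean `α T`,
and all the others have mean `T`. -/
noncomputable def countLaw (α T : ℝ≥0) (M : ℕ) [NeZero M] : Measure (Fin M → ℕ) :=
  Measure.pi (fun i => poissonMeasure (if i = 0 then α * T else T))

/-- The law of an index that, conditionally on the variables `Z` with law `countLaw α T M`, is
uniformly distributed over the set `S Z`. -/
noncomputable def guessLaw (α T : ℝ≥0) (M : ℕ) [NeZero M]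
    (S : (Fin M → ℕ) → Set (Fin M)) : Measure (Fin M) :=
  (countLaw α T M).bind (fun z => uniformOn (S z))

end OCPC

/-! Relative to the law under which every band has intensity 1, message `k` has likelihood
`e^{(1-α)T} α^{N_k}`, where `N_k` counts the points met along the input of message `k`. The
probabilities of correct decoding therefore sum to at most `e^{(1-α)T} E[max_k α^{N_k}]`. Each `N_k`
is Poisson of mean `T`, but inputs that meet in a band share points. As all the `N_k` are increasing
functions of the same independent counts, Harris' inequality makes the events `α^{N_k} ≤ t`
positively correlated, so the maximum is stochastically largest when the `N_k` are independent, as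
for messages in separate bands (`lintegral_iSup_pow_sum_le`). The resulting bound is `optimalScore`.

No density on path space is needed. Each cell of a finite grid is split according to the set of
messages that occupy it, which leaves finitely many independent Poisson counts
(`sum_pi_poissonMeasure_cells_le`). General decoding sets are approximated by events that depend on
finitely many observations (`sum_measure_le`).

Conversely, constant inputs with maximum likelihood decoding of the final counts attain the bound
(`exists_code_hasErrorProb`); their output laws are built from a Poisson number of uniform points.
By symmetry between the messages, a uniform guess among the extremal counts has the same error
probability (`guessLaw_real_ne_zero`). -/

namespace OCPC

/-! ### Positive association on finite powers of `ℕ` -/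

section Harris

/-- This is `(b - a) * (d - c) ≥ 0`, expanded so that no truncated subtraction occurs. -/
theorem mul_add_mul_le_of_same_order {a b c d : ℝ≥0∞}
    (h : (a ≤ b ∧ c ≤ d) ∨ (b ≤ a ∧ d ≤ c)) : a * d + b * c ≤ a * c + b * d := by
  rcases h with ⟨h₁, h₂⟩ | ⟨h₁, h₂⟩
  · obtain ⟨e, rfl⟩ := exists_add_of_le h₁
    obtain ⟨f, rfl⟩ := exists_add_of_le h₂
    calc a * (c + f) + (a + e) * c ≤ a * (c + f) + (a + e) * c + e * f := le_self_add
      _ = _ := by ring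
  · obtain ⟨e, rfl⟩ := exists_add_of_le h₁
    obtain ⟨f, rfl⟩ := exists_add_of_le h₂
    calc (b + e) * d + b * (d + f) ≤ (b + e) * d + b * (d + f) + e * f := le_self_add
      _ = _ := by ring

/-- **Chebyshev's integral inequality**. -/
theorem lintegral_mul_lintegral_le {X : Type*} [MeasurableSpace X] (μ : Measure X)
    [IsProbabilityMeasure μ] {f g : X → ℝ≥0∞} (hf : Measurable f) (hg : Measurable g)
    (h : ∀ x y, (f x ≤ f y ∧ g x ≤ g y) ∨ (f y ≤ f x ∧ g y ≤ g x)) :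
    (∫⁻ x, f x ∂μ) * ∫⁻ x, g x ∂μ ≤ ∫⁻ x, f x * g x ∂μ := by
  -- The pointwise inequality is integrated over two independent copies of `μ`; both sides are then
  -- twice the quantities to be compared.
  have key : ∫⁻ x, ∫⁻ y, (f x * g y + f y * g x) ∂μ ∂μ
      ≤ ∫⁻ x, ∫⁻ y, (f x * g x + f y * g y) ∂μ ∂μ :=
    lintegral_mono fun x ↦ lintegral_mono fun y ↦ mul_add_mul_le_of_same_order (h x y)
  have h₁ : ∀ x, ∫⁻ y, (f x * g y + f y * g x) ∂μ
      = f x * (∫⁻ y, g y ∂μ) + (∫⁻ y, f y ∂μ) * g x := fun x ↦ by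
    rw [lintegral_add_left (by fun_prop), lintegral_const_mul _ hg, lintegral_mul_const _ hf]
  have h₂ : ∀ x, ∫⁻ y, (f x * g x + f y * g y) ∂μ = f x * g x + ∫⁻ y, f y * g y ∂μ := fun x ↦ by
    rw [lintegral_add_left (by fun_prop)]; simp
  simp_rw [h₁, h₂] at key
  rw [lintegral_add_left (by fun_prop), lintegral_add_left (by fun_prop),
    lintegral_mul_const _ hf, lintegral_const_mul _ hg, lintegral_const, measure_univ, mul_one,
    ← two_mul, ← two_mul] at key
  exact (ENNReal.mul_le_mul_iff_right two_ne_zero ENNReal.ofNat_ne_top).1 key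

variable {ι : Type*} [DecidableEq ι] (μ : ι → Measure ℕ)

theorem monotone_lmarginal (s : Finset ι) {f : (ι → ℕ) → ℝ≥0∞} (hf : Monotone f) :
    Monotone (lmarginal μ s f) := fun x y hxy ↦
  lintegral_mono fun z ↦ hf fun i ↦ by
    by_cases h : i ∈ s <;> simp [Function.updateFinset, h, hxy i]

theorem antitone_lmarginal (s : Finset ι) {f : (ι → ℕ) → ℝ≥0∞} (hf : Antitone f) :
    Antitone (lmarginal μ s f) := fun x y hxy ↦
  lintegral_mono fun z ↦ hf fun i ↦ by
    by_cases h : i ∈ s <;> simp [Function.updateFinset, h, hxy i]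

variable [Fintype ι] [∀ i, IsProbabilityMeasure (μ i)]

/-- Coordinates are integrated out one at a time. Partial integrals keep the monotonicity in the
remaining coordinates, so Chebyshev's inequality applies to each new one. -/
theorem lmarginal_mul_lmarginal_le {f g : (ι → ℕ) → ℝ≥0∞}
    (h : (Monotone f ∧ Monotone g) ∨ (Antitone f ∧ Antitone g)) (s : Finset ι) :
    lmarginal μ s f * lmarginal μ s g ≤ lmarginal μ s (f * g) := by
  induction s using Finset.induction_on with
  | empty => simp
  | insert i s hi ih =>
    intro x
    rw [Pi.mul_apply, lmarginal_insert _ .of_discrete hi, lmarginal_insert _ .of_discrete hi,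
      lmarginal_insert _ .of_discrete hi]
    refine (lintegral_mul_lintegral_le (μ i) .of_discrete .of_discrete fun a b ↦ ?_).trans
      (lintegral_mono fun y ↦ ih _)
    have hu {a b : ℕ} (hab : a ≤ b) : Function.update x i a ≤ Function.update x i b :=
      Function.update_mono hab
    rcases h with ⟨hf, hg⟩ | ⟨hf, hg⟩ <;> rcases le_total a b with hab | hab
    · exact .inl ⟨monotone_lmarginal μ s hf (hu hab), monotone_lmarginal μ s hg (hu hab)⟩
    · exact .inr ⟨monotone_lmarginal μ s hf (hu hab), monotone_lmarginal μ s hg (hu hab)⟩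
    · exact .inr ⟨antitone_lmarginal μ s hf (hu hab), antitone_lmarginal μ s hg (hu hab)⟩
    · exact .inl ⟨antitone_lmarginal μ s hf (hu hab), antitone_lmarginal μ s hg (hu hab)⟩

/-- **Harris' inequality** for two functions on a finite power of `ℕ`. -/
theorem lintegral_pi_mul_le {f g : (ι → ℕ) → ℝ≥0∞}
    (h : (Monotone f ∧ Monotone g) ∨ (Antitone f ∧ Antitone g)) :
    (∫⁻ x, f x ∂Measure.pi μ) * ∫⁻ x, g x ∂Measure.pi μ ≤ ∫⁻ x, f x * g x ∂Measure.pi μ := by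
  have := lmarginal_mul_lmarginal_le μ h Finset.univ 0
  simpa [lmarginal_univ] using this

/-- **Harris' inequality** for finitely many functions. -/
theorem prod_lintegral_pi_le {κ : Type*} (s : Finset κ) {f : κ → (ι → ℕ) → ℝ≥0∞}
    (h : (∀ k, Monotone (f k)) ∨ (∀ k, Antitone (f k))) :
    ∏ k ∈ s, ∫⁻ x, f k x ∂Measure.pi μ ≤ ∫⁻ x, ∏ k ∈ s, f k x ∂Measure.pi μ := by
  classical
  induction s using Finset.induction_on with
  | empty => simp
  | insert i s hi ih =>
    simp_rw [Finset.prod_insert hi]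
    refine (mul_le_mul_right ih _).trans (lintegral_pi_mul_le μ ?_)
    exact h.imp (fun h ↦ ⟨h i, fun x y hxy ↦ Finset.prod_le_prod' fun k _ ↦ h k hxy⟩)
      (fun h ↦ ⟨h i, fun x y hxy ↦ Finset.prod_le_prod' fun k _ ↦ h k hxy⟩)

end Harris

/-! ### Likelihood ratios and superposition of Poisson variables -/

section Poisson

variable {ι : Type*} [Fintype ι]

theorem poissonMeasure_mul_singleton (a r : ℝ≥0) (n : ℕ) :
    poissonMeasure (a * r) {n} =
      ENNReal.ofReal (Real.exp ((1 - a) * r)) * (a : ℝ≥0∞) ^ n * poissonMeasure r {n} := by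
  rw [poissonMeasure_singleton, poissonMeasure_singleton, ← ENNReal.ofReal_coe_nnreal (p := a),
    ← ENNReal.ofReal_pow (NNReal.coe_nonneg a), ← ENNReal.ofReal_mul (by positivity),
    ← ENNReal.ofReal_mul (by positivity)]
  congr 1
  rw [show (1 - (a : ℝ)) * r = -((a * r : ℝ≥0) : ℝ) - (-r) by push_cast; ring, Real.exp_sub]
  push_cast
  field_simp
  rw [mul_pow]

theorem pi_poissonMeasure_mul (a r : ι → ℝ≥0) :
    Measure.pi (fun i ↦ poissonMeasure (a i * r i)) =
      (Measure.pi fun i ↦ poissonMeasure (r i)).withDensity (fun n ↦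
        ENNReal.ofReal (Real.exp (∑ i, (1 - (a i : ℝ)) * r i)) * ∏ i, (a i : ℝ≥0∞) ^ n i) := by
  refine Measure.ext_of_singleton fun n ↦ ?_
  rw [withDensity_apply _ (measurableSet_singleton _), lintegral_singleton, Measure.pi_singleton,
    Measure.pi_singleton]
  simp_rw [poissonMeasure_mul_singleton, Finset.prod_mul_distrib]
  rw [Real.exp_sum, ENNReal.ofReal_prod_of_nonneg fun i _ ↦ by positivity]

/-- The likelihood ratio against the law with all factors equal to 1 depends on the counts only
through their total over `p`. -/
theorem pi_poissonMeasure_ite_apply (α : ℝ≥0) (r : ι → ℝ≥0) (p : ι → Prop) [DecidablePred p]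
    (A : Set (ι → ℕ)) :
    Measure.pi (fun i ↦ poissonMeasure ((if p i then α else 1) * r i)) A =
      ENNReal.ofReal (Real.exp ((1 - α) * ∑ i with p i, (r i : ℝ))) *
        ∫⁻ n in A, (α : ℝ≥0∞) ^ (∑ i with p i, n i) ∂Measure.pi fun i ↦ poissonMeasure (r i) := by
  rw [pi_poissonMeasure_mul, withDensity_apply _ .of_discrete,
    lintegral_const_mul _ .of_discrete]
  congr 2
  · congr 2
    rw [Finset.mul_sum, Finset.sum_filter]
    exact Finset.sum_congr rfl fun i _ ↦ by split_ifs <;> simp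
  · ext n
    rw [← Finset.prod_pow_eq_pow_sum, Finset.prod_filter]
    exact Finset.prod_congr rfl fun i _ ↦ by split_ifs <;> simp

theorem hasLaw_sum_poissonMeasure {Ω ι : Type*} [MeasurableSpace Ω] {P : Measure Ω}
    {X : ι → Ω → ℕ} {r : ι → ℝ≥0} (hi : iIndepFun X P)
    (hX : ∀ i, HasLaw (X i) (poissonMeasure (r i)) P)
    (s : Finset ι) : HasLaw (fun ω ↦ ∑ i ∈ s, X i ω) (poissonMeasure (∑ i ∈ s, r i)) P := by
  classical
  have := hi.isProbabilityMeasure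
  induction s using Finset.induction_on with
  | empty =>
    refine ⟨by fun_prop, Measure.ext_of_singleton fun n ↦ ?_⟩
    cases n <;> simp [poissonMeasure_singleton]
  | insert i s his ih =>
    have h := hi.indepFun_finsetSum_of_notMem₀ (fun i ↦ (hX i).aemeasurable) his
    have h' := IndepFun.hasLaw_add_poissonMeasure h.symm (hX i) (by
      convert ih using 1; ext; simp)
    rw [Finset.sum_insert his]
    convert h' using 1
    ext ω; simp [Finset.sum_insert his]

theorem iIndepFun_eval_pi (r : ι → ℝ≥0) :
    iIndepFun (fun i (n : ι → ℕ) ↦ n i) (Measure.pi fun i ↦ poissonMeasure (r i)) :=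
  iIndepFun_pi (X := fun _ n ↦ n) fun _ ↦ by fun_prop

theorem hasLaw_eval_pi (r : ι → ℝ≥0) (i : ι) :
    HasLaw (fun n : ι → ℕ ↦ n i) (poissonMeasure (r i))
      (Measure.pi fun i ↦ poissonMeasure (r i)) :=
  (measurePreserving_eval (fun i ↦ poissonMeasure (r i)) i).hasLaw

end Poisson

/-! ### Independent counts maximize the score -/

theorem lintegral_eq_lintegral_tail {X : Type*} [MeasurableSpace X] (μ : Measure X)
    {f : X → ℝ≥0∞} (hf : Measurable f) (hf' : ∀ x, f x ≠ ∞) :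
    ∫⁻ x, f x ∂μ = ∫⁻ t in Set.Ioi (0 : ℝ), μ {x | ENNReal.ofReal t < f x} := by
  have := lintegral_eq_lintegral_meas_lt μ (f := fun x ↦ (f x).toReal)
    (Filter.Eventually.of_forall fun _ ↦ ENNReal.toReal_nonneg) (by fun_prop)
  simp_rw [ENNReal.ofReal_toReal (hf' _)] at this
  rw [this]
  refine setLIntegral_congr_fun measurableSet_Ioi fun t ht ↦ ?_
  congr! 3 with x
  rw [ENNReal.ofReal_lt_iff_lt_toReal (le_of_lt ht) (hf' x)]

/-- The expectation of `max_k α ^ Z_k` for independent Poisson variables `Z_k` of mean `T`, times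
the normalizing constant of the likelihood ratios. It is the number of messages times the optimal
probability of correct decoding. -/
noncomputable def optimalScore (α T : ℝ≥0) (M : ℕ) : ℝ≥0∞ :=
  ENNReal.ofReal (Real.exp ((1 - α) * T)) *
    ∫⁻ z, ⨆ k : Fin M, (α : ℝ≥0∞) ^ z k ∂Measure.pi fun _ : Fin M ↦ poissonMeasure T

theorem iSup_pow_ne_top {M : ℕ} (α : ℝ≥0) (z : Fin M → ℕ) :
    ⨆ k : Fin M, (α : ℝ≥0∞) ^ z k ≠ ∞ := by
  refine ne_top_of_le_ne_top (b := ∑ k, (α : ℝ≥0∞) ^ z k) ?_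
    (iSup_le fun k ↦ Finset.single_le_sum (f := fun k ↦ (α : ℝ≥0∞) ^ z k) (by simp)
      (Finset.mem_univ k))
  simp [ENNReal.sum_eq_top]

section Score

variable {ι : Type*} [Fintype ι] [DecidableEq ι] {M : ℕ}

/-- By superposition each sum over `s k` is Poisson of mean `T`, so the left side is the product of
the probabilities of the events on the right, and Harris' inequality compares it with the
probability of their intersection. The sets `s k` may overlap. -/
theorem prod_measure_le_measure_sum_mem (α : ℝ≥0) (r : ι → ℝ≥0) (T : ℝ≥0) (s : Fin M → Finset ι)
    (hs : ∀ k, ∑ i ∈ s k, r i = T) (t : ℝ≥0∞) :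
    Measure.pi (fun _ : Fin M ↦ poissonMeasure T) {z | ∀ k, (α : ℝ≥0∞) ^ z k ≤ t} ≤
      Measure.pi (fun i ↦ poissonMeasure (r i))
        {n | ∀ k, (α : ℝ≥0∞) ^ (∑ i ∈ s k, n i) ≤ t} := by
  set W : Set ℕ := {m | (α : ℝ≥0∞) ^ m ≤ t} with hW
  set f : Fin M → (ι → ℕ) → ℝ≥0∞ := fun k n ↦ W.indicator 1 (∑ i ∈ s k, n i) with hf
  have hN (k : Fin M) : Monotone fun n : ι → ℕ ↦ ∑ i ∈ s k, n i :=
    fun n m h ↦ Finset.sum_le_sum fun i _ ↦ h i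
  -- `W` is an upper set if `α ≤ 1` and a lower set if `α ≥ 1`, the same one for all `k`.
  have hmon : (∀ k, Monotone (f k)) ∨ (∀ k, Antitone (f k)) := by
    have key {a b : ℕ} (hab : a ∈ W → b ∈ W) :
        W.indicator (1 : ℕ → ℝ≥0∞) a ≤ W.indicator 1 b := by
      by_cases ha : a ∈ W
      · simp [ha, hab ha]
      · simp [ha]
    rcases le_total α 1 with h | h
    · refine .inl fun k n m hnm ↦ key fun ha ↦
        Set.mem_ofPred.2 ((?_ : _ ≤ _).trans (Set.mem_ofPred.1 ha))
      exact pow_le_pow_right_of_le_one' (mod_cast h) (hN k hnm)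
    · refine .inr fun k n m hnm ↦ key fun ha ↦
        Set.mem_ofPred.2 ((?_ : _ ≤ _).trans (Set.mem_ofPred.1 ha))
      exact pow_le_pow_right' (mod_cast h) (hN k hnm)
  have key := prod_lintegral_pi_le (fun i ↦ poissonMeasure (r i)) Finset.univ hmon
  have h₁ (k : Fin M) : ∫⁻ n, f k n ∂Measure.pi (fun i ↦ poissonMeasure (r i))
      = poissonMeasure T W := by
    have hl := hasLaw_sum_poissonMeasure (iIndepFun_eval_pi r) (hasLaw_eval_pi r) (s k)
    rw [hs k] at hl
    rw [← hl.map_eq, ← lintegral_indicator_one .of_discrete, lintegral_map .of_discrete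
      .of_discrete]
  have h₂ (n : ι → ℕ) : ∏ k, f k n
      = Set.indicator {n : ι → ℕ | ∀ k, ∑ i ∈ s k, n i ∈ W} 1 n := by
    by_cases h : ∀ k, ∑ i ∈ s k, n i ∈ W
    · simp [hf, h]
    · rw [Set.indicator_of_notMem (by exact h)]
      push Not at h
      obtain ⟨k, hk⟩ := h
      exact Finset.prod_eq_zero (Finset.mem_univ k) (Set.indicator_of_notMem hk _)
  simp_rw [h₁, h₂] at key
  rw [lintegral_indicator_one .of_discrete] at key
  refine le_of_eq_of_le ?_ key
  rw [← Measure.pi_pi]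
  congr 1
  ext z
  simp [hW]

theorem lintegral_iSup_pow_sum_le (α : ℝ≥0) (r : ι → ℝ≥0) (T : ℝ≥0) (s : Fin M → Finset ι)
    (hs : ∀ k, ∑ i ∈ s k, r i = T) :
    ∫⁻ n, ⨆ k : Fin M, (α : ℝ≥0∞) ^ (∑ i ∈ s k, n i) ∂Measure.pi (fun i ↦ poissonMeasure (r i)) ≤
      ∫⁻ z, ⨆ k : Fin M, (α : ℝ≥0∞) ^ z k ∂Measure.pi fun _ : Fin M ↦ poissonMeasure T := by
  rw [lintegral_eq_lintegral_tail _ .of_discrete fun n ↦ iSup_pow_ne_top α _,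
    lintegral_eq_lintegral_tail _ .of_discrete fun n ↦ iSup_pow_ne_top α _]
  refine lintegral_mono fun t ↦ ?_
  have h := prod_measure_le_measure_sum_mem α r T s hs (ENNReal.ofReal t)
  have h' := tsub_le_tsub_left h 1
  rw [← prob_compl_eq_one_sub .of_discrete, ← prob_compl_eq_one_sub .of_discrete] at h'
  convert h' using 2 <;> ext <;> simp [lt_iSup_iff]

/-- Among all families of hypotheses under which the coordinates are independent Poisson variables
with mean `α * r i` for `i ∈ s k` and `r i` otherwise, where the sets `s k` have total
weight `T`, the one with disjoint sets `s k` has the best decoder. -/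
theorem sum_pi_poissonMeasure_le (α : ℝ≥0) (r : ι → ℝ≥0) (T : ℝ≥0) (s : Fin M → Finset ι)
    (hs : ∀ k, ∑ i ∈ s k, r i = T) (A : Fin M → Set (ι → ℕ))
    (hA : Pairwise fun j k ↦ Disjoint (A j) (A k)) :
    ∑ k, Measure.pi (fun i ↦ poissonMeasure ((if i ∈ s k then α else 1) * r i)) (A k) ≤
      optimalScore α T M := by
  have hr (k : Fin M) : ∑ i with i ∈ s k, (r i : ℝ) = T := by
    rw [← hs k]; simp
  simp_rw [pi_poissonMeasure_ite_apply, hr]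
  rw [← Finset.mul_sum, optimalScore]
  gcongr
  refine le_trans ?_ (lintegral_iSup_pow_sum_le α r T s hs)
  -- On each decoding set the likelihood is at most the largest one; as the sets are disjoint, these
  -- integrals add up to at most the full integral.
  calc _ ≤ ∑ k, ∫⁻ n in A k, ⨆ k : Fin M, (α : ℝ≥0∞) ^ (∑ i ∈ s k, n i)
        ∂Measure.pi (fun i ↦ poissonMeasure (r i)) := by
        refine Finset.sum_le_sum fun k _ ↦ lintegral_mono fun n ↦ ?_
        simpa using le_iSup (fun k ↦ (α : ℝ≥0∞) ^ (∑ i ∈ s k, n i)) k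
    _ = ∫⁻ n in ⋃ k, A k, ⨆ k : Fin M, (α : ℝ≥0∞) ^ (∑ i ∈ s k, n i)
        ∂Measure.pi (fun i ↦ poissonMeasure (r i)) := by
        rw [lintegral_iUnion (fun _ ↦ .of_discrete) hA, tsum_fintype]
    _ ≤ _ := setLIntegral_le_lintegral _ _

end Score

/-! ### Splitting the count of a cell by the sets of occupants -/

section Splitting

variable {κ J : Type*} [Fintype κ] [Fintype J]

/-- On the iterated product `Q` the rows are independent and each row sum is Poisson by
superposition; flattening `Q` gives the product over pairs. -/
theorem hasLaw_pi_sum (r : κ × J → ℝ≥0) :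
    HasLaw (fun (n : κ × J → ℕ) c ↦ ∑ j, n (c, j))
      (Measure.pi fun c ↦ poissonMeasure (∑ j, r (c, j)))
      (Measure.pi fun p ↦ poissonMeasure (r p)) := by
  set Q : Measure (κ → J → ℕ) := Measure.pi fun c ↦ Measure.pi fun j ↦ poissonMeasure (r (c, j))
    with hQ
  have hrow (c : κ) : HasLaw (fun ω : κ → J → ℕ ↦ ω c)
      (Measure.pi fun j ↦ poissonMeasure (r (c, j))) Q :=
    (measurePreserving_eval (fun c ↦ Measure.pi fun j ↦ poissonMeasure (r (c, j))) c).hasLaw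
  have hind : iIndepFun (fun c (ω : κ → J → ℕ) ↦ ω c) Q :=
    iIndepFun_pi (X := fun _ ω ↦ ω) fun _ ↦ by fun_prop
  have hcoord (c : κ) (j : J) : HasLaw (fun ω : κ → J → ℕ ↦ ω c j) (poissonMeasure (r (c, j))) Q :=
    (hasLaw_eval_pi (fun j ↦ r (c, j)) j).fun_comp (hrow c)
  have hcols (c : κ) : iIndepFun (fun j (ω : κ → J → ℕ) ↦ ω c j) Q := by
    rw [iIndepFun_iff_map_fun_eq_pi_map fun j ↦ (hcoord c j).aemeasurable]
    simp_rw [(hcoord c _).map_eq]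
    exact (hrow c).map_eq
  have hflat := iIndepFun_uncurry' (X := fun c j (ω : κ → J → ℕ) ↦ ω c j) (by fun_prop) hind hcols
  have h₁ := hflat.hasLaw_pi fun p : κ × J ↦ hcoord p.1 p.2
  have h₂ := iIndepFun.hasLaw_pi
    (fun c ↦ hasLaw_sum_poissonMeasure (hcols c) (hcoord c) Finset.univ)
    (hind.comp (fun _ (w : J → ℕ) ↦ ∑ j, w j) fun _ ↦ .of_discrete)
  exact HasLaw.comp_of_hasLaw_comp (f := fun (n : κ × J → ℕ) c ↦ ∑ j, n (c, j))
    (.of_discrete) h₁ .id h₂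

theorem hasLaw_pi_inl (r : κ ⊕ J → ℝ≥0) :
    HasLaw (fun (n : κ ⊕ J → ℕ) c ↦ n (.inl c)) (Measure.pi fun c ↦ poissonMeasure (r (.inl c)))
      (Measure.pi fun p ↦ poissonMeasure (r p)) :=
  ((iIndepFun_eval_pi r).precomp Sum.inl_injective).hasLaw_pi fun _ ↦ hasLaw_eval_pi r _

/-- The bound for hypotheses under which the count of each cell `c` is the sum of Poisson variables
that belong to the sets `S` of messages, with mean `α * r c S` if the true message is in `S`,
and `r c S` otherwise. -/
theorem sum_pi_poissonMeasure_cells_le {M : ℕ} (α T : ℝ≥0)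
    (r : κ → Finset (Fin M) → ℝ≥0) (hr : ∀ k, ∑ c, ∑ S with k ∈ S, r c S ≤ T)
    (A : Fin M → Set (κ → ℕ)) (hA : Pairwise fun j k ↦ Disjoint (A j) (A k)) :
    ∑ k, Measure.pi (fun c ↦ poissonMeasure (∑ S, (if k ∈ S then α else 1) * r c S)) (A k) ≤
      optimalScore α T M := by
  classical
  -- One fictitious count per message raises its total weight from at most `T` to exactly `T`. The
  -- decoder sees neither these counts nor the splitting, only the cell totals `g n`, so it is a
  -- special decoder of the finer model.
  let r' : (κ × Finset (Fin M)) ⊕ Fin M → ℝ≥0 :=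
    Sum.elim (fun p ↦ r p.1 p.2) fun k ↦ T - ∑ c, ∑ S with k ∈ S, r c S
  let s : Fin M → Finset ((κ × Finset (Fin M)) ⊕ Fin M) := fun k ↦
    (Finset.univ ×ˢ Finset.univ.filter fun S ↦ k ∈ S).disjSum {k}
  let g : ((κ × Finset (Fin M)) ⊕ Fin M → ℕ) → κ → ℕ := fun n c ↦ ∑ S, n (.inl (c, S))
  have hs (k : Fin M) : ∑ i ∈ s k, r' i = T := by
    rw [Finset.sum_disjSum, Finset.sum_product, Finset.sum_singleton]
    exact add_tsub_cancel_of_le (hr k)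
  refine le_of_eq_of_le (Finset.sum_congr rfl fun k _ ↦ ?_) (sum_pi_poissonMeasure_le α r' T s hs
    (fun k ↦ g ⁻¹' A k) fun j k h ↦ (hA h).preimage g)
  have hl := (hasLaw_pi_sum fun p ↦ (if Sum.inl p ∈ s k then α else 1) * r' (.inl p)).comp
    (hasLaw_pi_inl fun i ↦ (if i ∈ s k then α else 1) * r' i)
  rw [← Measure.map_apply .of_discrete .of_discrete]
  refine Eq.trans ?_ (congrArg (fun μ ↦ μ (A k)) hl.map_eq.symm)
  simp [s, r']

end Splitting

/-! ### Finitely many observations as increments on a grid -/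

section Increments

variable {L : ℕ∞} {T : ℝ≥0}

/-- The increments of the paths in the bands of `F` over the intervals of the grid `t`. -/
def increments {n : ℕ} (F : Finset (Band L)) (t : Fin (n + 1) → Time T) (y : Output L T) :
    F × Fin n → ℕ :=
  fun p ↦ (y p.1).1 (t p.2.succ) - (y p.1).1 (t p.2.castSucc)

theorem measurable_path_eval (t : Time T) : Measurable fun w : CountingPath T ↦ w.1 t :=
  (measurable_pi_apply t).comp measurable_subtype_coe

theorem measurable_nat_sub {Ω : Type*} [MeasurableSpace Ω] {f g : Ω → ℕ}
    (hf : Measurable f) (hg : Measurable g) : Measurable fun ω ↦ f ω - g ω :=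
  (Measurable.of_discrete (f := fun p : ℕ × ℕ ↦ p.1 - p.2)).comp (hf.prodMk hg)

theorem measurable_eval (i : Band L) (t : Time T) : Measurable fun y : Output L T ↦ (y i).1 t :=
  (measurable_path_eval t).comp (measurable_pi_apply i)

theorem hasLaw_increments {α : ℝ≥0} {x : Time T → Band L} {P : Measure (Output L T)}
    (h : IsOutputLaw α x P) {n : ℕ} (F : Finset (Band L)) {t : Fin (n + 1) → Time T}
    (ht : StrictMono t) :
    HasLaw (increments F t) (Measure.pi fun p : F × Fin n ↦ poissonMeasure
      (∫ τ in Set.Ioc (t p.2.castSucc) (t p.2.succ), intensity α x p.1 τ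
        ∂(Measure.comap Subtype.val volume : Measure (Time T))).toNNReal) P := by
  refine iIndepFun.hasLaw_pi (X := fun (p : F × Fin n) (y : Output L T) ↦
    (y p.1).1 (t p.2.succ) - (y p.1).1 (t p.2.castSucc))
    (fun p ↦ h.law_increment p.1 _ _ (ht p.2.castSucc_lt_succ)) ?_
  refine iIndepFun_uncurry' (X := fun (i : F) (j : Fin n) (y : Output L T) ↦
    (y i).1 (t j.succ) - (y i).1 (t j.castSucc))
    (fun _ _ ↦ measurable_nat_sub (measurable_eval _ _) (measurable_eval _ _)) ?_
    fun i ↦ h.indep_increments i n t ht.monotone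
  exact (h.indep_bands.precomp Subtype.val_injective).comp
    (fun _ (w : CountingPath T) (j : Fin n) ↦ w.1 (t j.succ) - w.1 (t j.castSucc))
    fun _ ↦ measurable_pi_lambda _ fun _ ↦
      measurable_nat_sub (measurable_path_eval _) (measurable_path_eval _)

theorem eval_eq_of_increments_eq {n : ℕ} (F : Finset (Band L)) {t : Fin (n + 1) → Time T}
    (ht : Monotone t) (h0 : t 0 = Time.start T) {y y' : Output L T}
    (h : increments F t y = increments F t y') (i : F) (j : Fin (n + 1)) :
    (y i).1 (t j) = (y' i).1 (t j) := by
  induction j using Fin.induction with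
  | zero => rw [h0, (y i).2.1, (y' i).2.1]
  | succ j ih =>
    have h₁ := congrFun h (i, j)
    -- Monotone paths make the truncated subtraction in `increments` exact.
    have h₂ := (y i).2.2.1 (ht j.castSucc_lt_succ.le)
    have h₃ := (y' i).2.2.1 (ht j.castSucc_lt_succ.le)
    simp only [increments] at h₁
    omega

theorem exists_preimage_increments (s : Finset (Band L × Time T)) :
    ∃ (n : ℕ) (F : Finset (Band L)) (t : Fin (n + 1) → Time T), StrictMono t ∧
      ∀ y y' : Output L T, increments F t y = increments F t y' →
        ∀ p ∈ s, (y p.1).1 p.2 = (y' p.1).1 p.2 := by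
  classical
  -- The grid has to start at time 0, where all paths vanish, for the increments to determine the
  -- values.
  set G : Finset (Time T) := insert (Time.start T) (s.image Prod.snd) with hG
  obtain ⟨n, hn⟩ : ∃ n, G.card = n + 1 :=
    ⟨G.card - 1, by have : 0 < G.card := Finset.card_pos.2 (by simp [hG]); omega⟩
  have hst := (G.orderEmbOfFin hn).strictMono
  refine ⟨n, s.image Prod.fst, G.orderEmbOfFin hn, hst, fun y y' h p hp ↦ ?_⟩
  have hmem (q : Time T) (hq : q ∈ G) : ∃ j, G.orderEmbOfFin hn j = q := by
    have := G.range_orderEmbOfFin hn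
    exact (Set.ext_iff.1 this q).2 hq
  have h0 : G.orderEmbOfFin hn 0 = Time.start T := by
    obtain ⟨j, hj⟩ := hmem (Time.start T) (by simp [hG])
    refine le_antisymm (hj ▸ hst.monotone (Fin.zero_le j)) (G.orderEmbOfFin hn 0).2.1
  obtain ⟨j, hj⟩ := hmem p.2 (by
    simp only [hG, Finset.mem_insert, Finset.mem_image]
    exact .inr ⟨p, hp, rfl⟩)
  rw [← hj]
  exact eval_eq_of_increments_eq _ hst.monotone h0 h
    ⟨p.1, Finset.mem_image_of_mem _ hp⟩ j

end Increments

/-! ### From channel inputs to Poisson cells -/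

section Cells

variable {L : ℕ∞} {T : ℝ≥0} {M : ℕ}

/-- Lebesgue measure on `[0, T]`. -/
noncomputable abbrev timeVolume (T : ℝ≥0) : Measure (Time T) := Measure.comap Subtype.val volume

theorem timeVolume_apply (T : ℝ≥0) (s : Set (Time T)) :
    timeVolume T s = volume (Subtype.val '' s) :=
  (MeasurableEmbedding.subtype_coe measurableSet_Icc).comap_apply _ _

theorem timeVolume_univ (T : ℝ≥0) : timeVolume T Set.univ = T := by
  rw [timeVolume_apply, Set.image_univ, Subtype.range_coe, Real.volume_Icc, sub_zero,
    ENNReal.ofReal_coe_nnreal]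

instance (T : ℝ≥0) : IsFiniteMeasure (timeVolume T) := ⟨by simp [timeVolume_univ]⟩

/-- The set of the messages that occupy band `i` at time `τ`. -/
def occupants (x : Fin M → Time T → Band L) (i : Band L) (τ : Time T) : Finset (Fin M) :=
  Finset.univ.filter fun k ↦ x k τ = i

theorem measurable_occupants {x : Fin M → Time T → Band L} (hx : ∀ k, Measurable (x k))
    (i : Band L) : @Measurable _ _ _ ⊤ (occupants x i) := by
  let : MeasurableSpace (Finset (Fin M)) := ⊤
  refine measurable_to_countable' fun S ↦ ?_
  have : occupants x i ⁻¹' {S} = ⋂ k, {τ | x k τ = i ↔ k ∈ S} := by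
    ext τ; simp [occupants, Finset.ext_iff]
  rw [this]
  refine .iInter fun k ↦ ?_
  by_cases hk : k ∈ S
  · simp only [hk, iff_true]
    exact hx k (measurableSet_singleton i)
  · simp only [hk, iff_false]
    exact (hx k (measurableSet_singleton i)).compl

/-- The intensity depends on the time only through the set of occupants of the band. The resulting
weights do not depend on `k`; only the factors `α` or 1 do. -/
theorem integral_intensity {x : Fin M → Time T → Band L} (hx : ∀ k, Measurable (x k)) (α : ℝ≥0)
    (k : Fin M) (i : Band L) (s : Set (Time T)) :
    (∫ τ in s, intensity α (x k) i τ ∂timeVolume T).toNNReal =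
      ∑ S, (if k ∈ S then α else 1) *
        ((timeVolume T).restrict s (occupants x i ⁻¹' {S})).toNNReal := by
  let : MeasurableSpace (Finset (Fin M)) := ⊤
  have hm := measurable_occupants hx i
  have h : ∀ τ, intensity α (x k) i τ
      = (fun S : Finset (Fin M) ↦ (((if k ∈ S then α else 1 : ℝ≥0)) : ℝ)) (occupants x i τ) := by
    intro τ
    by_cases h : x k τ = i <;> simp [intensity, occupants, h]
  simp_rw [h]
  rw [← integral_map (φ := occupants x i) hm.aemeasurable
    (f := fun S : Finset (Fin M) ↦ (((if k ∈ S then α else 1 : ℝ≥0)) : ℝ))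
    (Measurable.of_discrete.aestronglyMeasurable),
    integral_fintype .of_finite, ← NNReal.coe_inj, Real.coe_toNNReal _ (by positivity)]
  push_cast
  refine Finset.sum_congr rfl fun S _ ↦ ?_
  rw [smul_eq_mul, mul_comm, map_measureReal_apply hm .of_discrete]
  rfl

/-- An input is in one band at a time, so the times it spends in the various cells are disjoint
parts of `[0, T]`. They need not cover it, as only the bands of `F` are observed. -/
theorem sum_measure_occupants_le {x : Fin M → Time T → Band L} (hx : ∀ k, Measurable (x k))
    {n : ℕ} (F : Finset (Band L)) {t : Fin (n + 1) → Time T} (ht : Monotone t) (k : Fin M) :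
    ∑ p : F × Fin n, ∑ S with k ∈ S,
      ((timeVolume T).restrict (Set.Ioc (t p.2.castSucc) (t p.2.succ))
        (occupants x p.1 ⁻¹' {S})).toNNReal ≤ T := by
  let : MeasurableSpace (Finset (Fin M)) := ⊤
  have hm (i : Band L) := measurable_occupants hx i
  rw [← ENNReal.coe_le_coe]
  push_cast
  simp_rw [ENNReal.coe_toNNReal (measure_ne_top _ _)]
  have h₁ (p : F × Fin n) : ∑ S with k ∈ S, ((timeVolume T).restrict
      (Set.Ioc (t p.2.castSucc) (t p.2.succ)) (occupants x p.1 ⁻¹' {S}))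
      = timeVolume T (x k ⁻¹' {(p.1 : Band L)} ∩ Set.Ioc (t p.2.castSucc) (t p.2.succ)) := by
    rw [← Measure.restrict_apply (hx k (measurableSet_singleton _)),
      ← measure_biUnion_finset (fun S _ S' _ h ↦ ?_) fun S _ ↦ hm _ .of_discrete]
    · congr 1
      ext τ
      simp [occupants]
    · exact Disjoint.preimage _ (by simpa using h)
  simp_rw [h₁]
  rw [← timeVolume_univ T, ← measure_biUnion_finset (fun p _ q _ h ↦ ?_) fun p _ ↦
    (hx k (measurableSet_singleton _)).inter measurableSet_Ioc]
  · exact measure_mono (Set.subset_univ _)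
  · refine Set.disjoint_left.2 fun τ hp hq ↦ h ?_
    refine Prod.ext (Subtype.ext (hp.1.symm.trans hq.1)) ?_
    by_contra hne
    rcases lt_or_gt_of_ne hne with hlt | hlt
    · exact absurd (hp.2.2.trans (ht (Fin.le_castSucc_iff.2 (by simpa using hlt)))) hq.2.1.not_ge
    · exact absurd (hq.2.2.trans (ht (Fin.le_castSucc_iff.2 (by simpa using hlt)))) hp.2.1.not_ge

variable {α : ℝ≥0} {x : Fin M → Time T → Band L} {P : Fin M → Measure (Output L T)}

theorem sum_measure_le_of_depends_on_finset (hx : ∀ k, Measurable (x k))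
    (hP : ∀ k, IsOutputLaw α (x k) (P k)) (s : Finset (Band L × Time T))
    (A : Fin M → Set (Output L T)) (hA : Pairwise fun j k ↦ Disjoint (A j) (A k))
    (hs : ∀ k y y', (∀ p ∈ s, (y p.1).1 p.2 = (y' p.1).1 p.2) → y ∈ A k → y' ∈ A k) :
    ∑ k, P k (A k) ≤ optimalScore α T M := by
  obtain ⟨n, F, t, ht, hdet⟩ := exists_preimage_increments s
  -- Since the increments determine membership in `A k`, taking images loses nothing and preserves
  -- disjointness.
  have hpre (k : Fin M) : increments F t ⁻¹' (increments F t '' A k) = A k := by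
    refine Set.Subset.antisymm ?_ (Set.subset_preimage_image _ _)
    rintro y ⟨y', hy', h⟩
    exact hs k y' y (hdet _ _ h) hy'
  refine le_of_eq_of_le (Finset.sum_congr rfl fun k _ ↦ ?_) (sum_pi_poissonMeasure_cells_le α T _
    (sum_measure_occupants_le hx F ht.monotone) (fun k ↦ increments F t '' A k) fun j k hjk ↦ ?_)
  · have hl := hasLaw_increments (hP k) F ht
    simp_rw [integral_intensity hx] at hl
    rw [← hl.map_eq, Measure.map_apply_of_aemeasurable hl.aemeasurable .of_discrete, hpre]
  · refine Set.disjoint_left.2 ?_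
    rintro _ ⟨y, hy, rfl⟩ ⟨y', hy', h⟩
    have hy'' : y ∈ A k := by rw [← hpre k]; exact ⟨y', hy', h⟩
    exact Set.disjoint_left.1 (hA hjk) hy hy''

end Cells

/-! ### The converse for arbitrary measurable decoders -/

section Converse

variable {L : ℕ∞} {T : ℝ≥0} {M : ℕ}

/-- The measurable sets of outputs that depend only on the values in finitely many bands at
finitely many times. -/
def cylinderEvents (L : ℕ∞) (T : ℝ≥0) : Set (Set (Output L T)) :=
  {B | MeasurableSet B ∧ ∃ s : Finset (Band L × Time T),
    ∀ y y', (∀ p ∈ s, (y p.1).1 p.2 = (y' p.1).1 p.2) → (y ∈ B ↔ y' ∈ B)}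

theorem isSetRing_cylinderEvents : IsSetRing (cylinderEvents L T) where
  empty_mem := ⟨.empty, ∅, fun _ _ _ ↦ .rfl⟩
  union_mem := by
    classical
    rintro A B ⟨hA, s, hs⟩ ⟨hB, t, ht⟩
    exact ⟨hA.union hB, s ∪ t, fun y y' h ↦
      or_congr (hs y y' fun p hp ↦ h p (Finset.mem_union_left _ hp))
        (ht y y' fun p hp ↦ h p (Finset.mem_union_right _ hp))⟩
  sdiff_mem := by
    classical
    rintro A B ⟨hA, s, hs⟩ ⟨hB, t, ht⟩
    exact ⟨hA.diff hB, s ∪ t, fun y y' h ↦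
      and_congr (hs y y' fun p hp ↦ h p (Finset.mem_union_left _ hp))
        (not_congr (ht y y' fun p hp ↦ h p (Finset.mem_union_right _ hp)))⟩

theorem generateFrom_cylinderEvents :
    (inferInstance : MeasurableSpace (Output L T)) =
      MeasurableSpace.generateFrom (cylinderEvents L T) := by
  refine le_antisymm ?_ (MeasurableSpace.generateFrom_le fun B hB ↦ hB.1)
  refine iSup_le fun i ↦ ?_
  have h : @Measurable _ _ (MeasurableSpace.generateFrom (cylinderEvents L T)) _
      fun y : Output L T ↦ y i := by
    refine @Measurable.subtype_mk _ _ (MeasurableSpace.generateFrom (cylinderEvents L T)) _ _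
      (fun y : Output L T ↦ (y i).1) ?_ fun y ↦ (y i).2
    refine @measurable_pi_lambda _ _ _ (MeasurableSpace.generateFrom (cylinderEvents L T)) _ _
      fun t B _ ↦ ?_
    refine MeasurableSpace.measurableSet_generateFrom
      ⟨measurable_eval i t .of_discrete, {(i, t)}, fun y y' h ↦ ?_⟩
    have := h (i, t) (by simp)
    simp only at this
    simp [this]
  exact h.comap_le

variable {α : ℝ≥0} {x : Fin M → Time T → Band L} {P : Fin M → Measure (Output L T)}

/-- No decoder does better than `optimalScore`, for any channel inputs. -/
theorem sum_measure_le (hx : ∀ k, Measurable (x k)) (hP : ∀ k, IsOutputLaw α (x k) (P k))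
    (A : Fin M → Set (Output L T)) (hAm : ∀ k, MeasurableSet (A k))
    (hA : Pairwise fun j k ↦ Disjoint (A j) (A k)) :
    ∑ k, P k (A k) ≤ optimalScore α T M := by
  classical
  have := fun k ↦ (hP k).isProbabilityMeasure
  refine ENNReal.le_of_forall_pos_le_add fun ε hε _ ↦ ?_
  -- Each of the `M` messages will lose at most `M * δ`; the summand 1 keeps the denominator
  -- nonzero.
  set δ : ℝ≥0∞ := ε / (M * M + 1) with hδ
  have hδ0 : 0 < δ := ENNReal.div_pos (by simpa using hε.ne') (by finiteness)
  -- Approximating under the sum of the laws controls the error under all of them at once.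
  have happ (k : Fin M) : ∃ B ∈ cylinderEvents L T, (∑ k, P k) (symmDiff B (A k)) < δ :=
    exists_measure_symmDiff_lt_of_generateFrom_isSetRing isSetRing_cylinderEvents
      ⟨{Set.univ}, Set.countable_singleton _,
        by simpa using ⟨.univ, ∅, fun _ _ _ ↦ .rfl⟩, by simp⟩
      generateFrom_cylinderEvents (hAm k) hδ0
  choose B hB hBA using happ
  choose s hs using fun k ↦ (hB k).2
  -- The approximations may overlap, so overlaps are discarded. A point of `A k` lost in this way
  -- lies in some `symmDiff (B j) (A j)`, because the `A j` are disjoint.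
  set B' : Fin M → Set (Output L T) := fun k ↦ B k \ ⋃ j ∈ {j | j ≠ k}, B j with hB'
  have hmain : ∑ k, P k (B' k) ≤ optimalScore α T M := by
    refine sum_measure_le_of_depends_on_finset hx hP (Finset.univ.biUnion s) B' ?_ ?_
    · intro j k hjk
      refine Set.disjoint_left.2 fun y hy hy' ↦ hy'.2 ?_
      exact Set.mem_biUnion (x := j) hjk hy.1
    · intro k y y' h hy
      have hiff (j : Fin M) : y ∈ B j ↔ y' ∈ B j :=
        hs j y y' fun p hp ↦ h p (Finset.mem_biUnion.2 ⟨j, Finset.mem_univ _, hp⟩)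
      simpa [hB', hiff] using hy
  have hstep (k : Fin M) : P k (A k) ≤ P k (B' k) + M * δ := by
    have hsub : A k ⊆ B' k ∪ ⋃ j, symmDiff (B j) (A j) := by
      intro y hy
      by_cases hyB : y ∈ B' k
      · exact .inl hyB
      refine .inr (Set.mem_iUnion.2 ?_)
      by_cases hk : y ∈ B k
      · have : ∃ j, j ≠ k ∧ y ∈ B j := by
          by_contra hcon
          push Not at hcon
          refine hyB ⟨hk, ?_⟩
          simpa using hcon
        obtain ⟨j, hj, hyj⟩ := this
        exact ⟨j, .inl ⟨hyj, fun h ↦ Set.disjoint_left.1 (hA hj) h hy⟩⟩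
      · exact ⟨k, .inr ⟨hy, hk⟩⟩
    refine (measure_mono hsub).trans ((measure_union_le _ _).trans ?_)
    gcongr
    refine (measure_iUnion_fintype_le _ _).trans ?_
    calc ∑ j, P k (symmDiff (B j) (A j)) ≤ ∑ _j : Fin M, δ := by
          refine Finset.sum_le_sum fun j _ ↦ le_trans ?_ (hBA j).le
          rw [Measure.finsetSum_apply]
          exact Finset.single_le_sum (f := fun k ↦ P k (symmDiff (B j) (A j))) (by simp)
            (Finset.mem_univ k)
      _ = M * δ := by simp
  calc ∑ k, P k (A k) ≤ ∑ k, (P k (B' k) + M * δ) := Finset.sum_le_sum fun k _ ↦ hstep k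
    _ = ∑ k, P k (B' k) + M * M * δ := by simp [Finset.sum_add_distrib, mul_assoc]
    _ ≤ optimalScore α T M + ε := by
      gcongr
      rw [hδ]
      calc (M * M : ℝ≥0∞) * (ε / (M * M + 1)) ≤ (M * M + 1) * (ε / (M * M + 1)) := by
            gcongr; exact le_self_add
        _ ≤ ε := ENNReal.mul_div_le

end Converse

/-! ### Maximum likelihood decoding of independent counts -/

section DiscreteDecoder

variable {M : ℕ}

/-- Where `d` decides for `k`, the likelihood of `k` is the supremum; these events partition the
space, so nothing is lost in the bound. -/
theorem sum_pi_poissonMeasure_decoder (α T : ℝ≥0) (d : (Fin M → ℕ) → Fin M)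
    (hd : ∀ (z : Fin M → ℕ) (j : Fin M), (α : ℝ≥0∞) ^ z j ≤ (α : ℝ≥0∞) ^ z (d z)) :
    ∑ k, Measure.pi (fun j ↦ poissonMeasure ((if j = k then α else 1) * T)) {z | d z = k} =
      optimalScore α T M := by
  have hk (k : Fin M) : ({j | j = k} : Finset (Fin M)) = {k} := by ext; simp
  simp_rw [pi_poissonMeasure_ite_apply α (fun _ ↦ T), hk, Finset.sum_singleton]
  rw [← Finset.mul_sum, optimalScore]
  congr 1
  have h (k : Fin M) : ∫⁻ z in {z | d z = k}, (α : ℝ≥0∞) ^ z k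
        ∂Measure.pi (fun _ : Fin M ↦ poissonMeasure T)
      = ∫⁻ z in {z | d z = k}, ⨆ k, (α : ℝ≥0∞) ^ z k
        ∂Measure.pi (fun _ : Fin M ↦ poissonMeasure T) := by
    refine setLIntegral_congr_fun .of_discrete fun z hz ↦ ?_
    obtain rfl : d z = k := hz
    exact le_antisymm (le_iSup (fun k ↦ (α : ℝ≥0∞) ^ z k) _) (iSup_le fun j ↦ hd z j)
  simp_rw [h]
  rw [← setLIntegral_univ (f := fun z : Fin M → ℕ ↦ ⨆ k, (α : ℝ≥0∞) ^ z k),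
    show (Set.univ : Set (Fin M → ℕ)) = ⋃ k, {z | d z = k} by ext; simp,
    lintegral_iUnion (fun _ ↦ .of_discrete) fun j k hjk ↦ ?_, tsum_fintype]
  exact Set.disjoint_left.2 fun z hz hz' ↦ hjk (hz.symm.trans hz')

theorem exists_optimal_decoder [NeZero M] (α : ℝ≥0) :
    ∃ d : (Fin M → ℕ) → Fin M,
      ∀ (z : Fin M → ℕ) (j : Fin M), (α : ℝ≥0∞) ^ z j ≤ (α : ℝ≥0∞) ^ z (d z) := by
  have h (z : Fin M → ℕ) := Finite.exists_max fun j ↦ (α : ℝ≥0∞) ^ z j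
  choose d hd using h
  exact ⟨d, hd⟩

theorem optimalScore_le [NeZero M] (α T : ℝ≥0) : optimalScore α T M ≤ M := by
  obtain ⟨d, hd⟩ := exists_optimal_decoder (M := M) α
  rw [← sum_pi_poissonMeasure_decoder α T d hd]
  exact (Finset.sum_le_sum fun k _ ↦ prob_le_one).trans (by simp)

theorem optimalScore_ne_top [NeZero M] (α T : ℝ≥0) : optimalScore α T M ≠ ∞ :=
  ne_top_of_le_ne_top (ENNReal.natCast_ne_top M) (optimalScore_le α T)

end DiscreteDecoder

/-! ### From decoding sets to the optimal error probability -/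

section ErrorBound

variable {L : ℕ∞} {T : ℝ≥0}

/-- Among `n` numbers one can select `m` whose average is at least the average of all. -/
theorem exists_injective_average_le {m n : ℕ} (hm : 1 ≤ m) (hmn : m ≤ n) (a : Fin n → ℝ) :
    ∃ g : Fin m → Fin n, Function.Injective g ∧ (∑ i, a i) * m ≤ (∑ i, a (g i)) * n := by
  induction n, hmn using Nat.le_induction with
  | base => exact ⟨id, Function.injective_id, le_rfl⟩
  | succ n hmn ih =>
    -- Removing a smallest number does not lower the average.
    obtain ⟨i, hi⟩ := Finite.exists_min a
    obtain ⟨g, hg, h⟩ := ih (fun j ↦ a (i.succAbove j))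
    refine ⟨fun j ↦ i.succAbove (g j), i.succAbove_right_injective.comp hg, ?_⟩
    have hsum := Fin.sum_univ_succAbove a i
    set S := ∑ j, a (i.succAbove j)
    have hn : (n : ℝ) * a i ≤ S := by
      have := Finset.card_nsmul_le_sum Finset.univ (fun j ↦ a (i.succAbove j)) (a i)
        fun j _ ↦ hi _
      simpa using this
    have hm' : (0 : ℝ) < m := by exact_mod_cast hm
    have hn' : (0 : ℝ) < n := by exact_mod_cast hm.trans hmn
    push_cast
    rw [hsum]
    have h1 : (a i + S) * n ≤ S * (n + 1) := by linarith
    have h2 : (a i + S) * m * n ≤ (∑ j, a (i.succAbove (g j))) * (n + 1) * n := by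
      calc (a i + S) * m * n = (a i + S) * n * m := by ring
        _ ≤ S * (n + 1) * m := by gcongr
        _ = S * m * (n + 1) := by ring
        _ ≤ (∑ j, a (i.succAbove (g j))) * n * (n + 1) := by gcongr
        _ = _ := by ring
    exact le_of_mul_le_mul_right h2 hn'

/-- `optError` also admits codes with more than `M` messages. From such a code, `M` messages are
kept whose average success probability is at least the overall one; their decoding sets stay
disjoint, which is all the converse needs. -/
theorem Code.hasErrorProb_ge {M M' : ℕ} [NeZero M] (hM : M ≤ M') {α : ℝ≥0} {c : Code L T M'}
    {e : ℝ} (h : c.HasErrorProb α e) : 1 - (optimalScore α T M).toReal / M ≤ e := by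
  obtain ⟨P, hP, rfl⟩ := h
  have := fun k ↦ (hP k).isProbabilityMeasure
  have hM0 : (0 : ℝ) < M := by exact_mod_cast NeZero.pos M
  have hM'0 : (0 : ℝ) < M' := by exact_mod_cast (NeZero.pos M).trans_le hM
  have hmeas (k : Fin M') : MeasurableSet {y | c.dec y = k} :=
    c.measurable_dec (measurableSet_singleton k)
  have herr (k : Fin M') : (P k).real {y | c.dec y ≠ k} = 1 - (P k).real {y | c.dec y = k} :=
    probReal_compl_eq_one_sub (hmeas k)
  simp_rw [herr]
  rw [Finset.sum_sub_distrib]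
  obtain ⟨g, hg, hav⟩ := exists_injective_average_le (NeZero.pos M) hM
    fun k ↦ (P k).real {y | c.dec y = k}
  have hsum := sum_measure_le (fun k ↦ c.measurable_enc (g k)) (fun k ↦ hP (g k))
    (fun k ↦ {y | c.dec y = g k}) (fun k ↦ hmeas _) fun j k hjk ↦
      Set.disjoint_left.2 fun y hy hy' ↦ hjk (hg (hy.symm.trans hy'))
  have hreal : ∑ i, (P (g i)).real {y | c.dec y = g i} ≤ (optimalScore α T M).toReal := by
    simp_rw [measureReal_def]
    rw [← ENNReal.toReal_sum fun k _ ↦ measure_ne_top _ _]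
    exact ENNReal.toReal_mono (optimalScore_ne_top α T) hsum
  simp only [Finset.sum_const, Finset.card_univ, Fintype.card_fin, nsmul_eq_mul, mul_one]
  rw [sub_div, div_self hM'0.ne', sub_le_sub_iff_left, div_le_div_iff₀ hM'0 hM0]
  exact hav.trans (by gcongr)

theorem optError_eq_of_hasErrorProb {M : ℕ} [NeZero M] {α : ℝ≥0} {c : Code L T M}
    (h : c.HasErrorProb α (1 - (optimalScore α T M).toReal / M)) :
    optError L α T M = 1 - (optimalScore α T M).toReal / M := by
  have hM0 : (0 : ℝ) < M := by exact_mod_cast NeZero.pos M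
  refine IsLeast.csInf_eq ⟨⟨?_, ?_⟩, ?_⟩
  · rw [sub_nonneg, div_le_one hM0]
    exact ENNReal.toReal_le_of_le_ofReal hM0.le (by simpa using optimalScore_le α T)
  · exact le_sSup ⟨M, NeZero.pos M, rfl, c, _, h, le_rfl⟩
  · rintro ε ⟨-, hε⟩
    -- A supremum that is at least the finite `M` forces a member that is at least `M`, since
    -- otherwise `M - 1` would be an upper bound.
    obtain ⟨m, ⟨M', -, rfl, c', e, hc', he⟩, hm⟩ : ∃ m ∈ {m : ℕ∞ | ∃ M : ℕ, 1 ≤ M ∧ m = M ∧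
        ∃ (c : Code L T M) (e : ℝ), c.HasErrorProb α e ∧ e ≤ ε}, (M : ℕ∞) ≤ m := by
      by_contra! hcon
      have hle : maxMessages L α T ε ≤ ((M - 1 : ℕ) : ℕ∞) := sSup_le fun m hm ↦ by
        have h₁ := hcon m hm
        obtain ⟨M', -, rfl, -⟩ := hm
        have : M' < M := by exact_mod_cast h₁
        exact_mod_cast Nat.le_sub_one_of_lt this
      have h₂ : M ≤ M - 1 := by exact_mod_cast hε.trans hle
      have := NeZero.pos M
      omega
    exact (Code.hasErrorProb_ge (by exact_mod_cast hm) hc').trans he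

end ErrorBound

/-! ### Multinomial counts and Poisson thinning -/

section PoissonCounts

variable {E κ : Type*} [DecidableEq κ]

/-- The number of the points with colour `j` among the first `n` points of the sequence `u`. -/
def colourCount (c : E → κ) (n : ℕ) (u : ℕ → E) (j : κ) : ℕ :=
  ((Finset.range n).filter fun i ↦ c (u i) = j).card

theorem colourCount_succ (c : E → κ) (n : ℕ) (u : ℕ → E) (j : κ) :
    colourCount c (n + 1) u j = colourCount c n u j + if c (u n) = j then 1 else 0 := by
  unfold colourCount
  rw [Finset.range_add_one, Finset.filter_insert]
  split_ifs
  · rw [Finset.card_insert_of_notMem (by simp)]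
  · rfl

theorem colourCount_succ_eq_iff (n : ℕ) (u : ℕ → E) (m : κ → ℕ) :
    colourCount c (n + 1) u = m ↔ m (c (u n)) ≠ 0 ∧
      colourCount c n u = Function.update m (c (u n)) (m (c (u n)) - 1) := by
  simp_rw [funext_iff, colourCount_succ]
  refine ⟨fun h ↦ ⟨?_, fun j ↦ ?_⟩, fun ⟨h₀, h⟩ j ↦ ?_⟩
  · rw [← h]; simp
  · rw [Function.update_apply]
    have := h j
    split_ifs with hj
    · subst hj; simp at this; omega
    · rw [if_neg (Ne.symm hj)] at this; omega
  · rw [h j, Function.update_apply]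
    split_ifs with h₁ h₂ h₂
    · subst h₁; omega
    · exact absurd h₁.symm h₂
    · exact absurd h₂.symm h₁
    · rfl

variable [MeasurableSpace E] [MeasurableSpace κ] [DiscreteMeasurableSpace κ] {c : E → κ}

theorem measurable_colourCount (hc : Measurable c) (n : ℕ) : Measurable (colourCount c n) := by
  refine measurable_pi_lambda _ fun j ↦ ?_
  induction n with
  | zero => exact measurable_const
  | succ n ih =>
    simp_rw [colourCount_succ]
    have h : Measurable fun u : ℕ → E ↦ if c (u n) = j then 1 else 0 :=
      (Measurable.of_discrete (f := fun k : κ ↦ if k = j then (1 : ℕ) else 0)).comp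
        (hc.comp (measurable_pi_apply n))
    exact ih.add h

variable [Fintype κ] (q : Measure E) [IsProbabilityMeasure q]

theorem measure_colour_inter_colourCount (hc : Measurable c) (n : ℕ) (j : κ) (m : κ → ℕ) :
    Measure.infinitePi (fun _ : ℕ ↦ q) ({u | c (u n) = j} ∩ {u | colourCount c n u = m}) =
      q (c ⁻¹' {j}) * Measure.infinitePi (fun _ : ℕ ↦ q) {u | colourCount c n u = m} := by
  have hind : iIndepFun (fun i (u : ℕ → E) ↦ c (u i)) (Measure.infinitePi fun _ : ℕ ↦ q) :=
    iIndepFun_infinitePi (P := fun _ : ℕ ↦ q) (X := fun _ ↦ c) fun _ ↦ hc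
  have h := (hind.indepFun_finset {n} (Finset.range n) (by simp)
    fun i ↦ hc.comp (measurable_pi_apply i))
  have h₂ := h.measure_inter_preimage_eq_mul {v | v ⟨n, by simp⟩ = j}
    {v | (fun k ↦ (Finset.univ.filter fun i ↦ v i = k).card) = m} .of_discrete .of_discrete
  have e₁ : {u : ℕ → E | c (u n) = j} = (fun u (i : ({n} : Finset ℕ)) ↦ c (u i)) ⁻¹'
      {v | v ⟨n, by simp⟩ = j} := rfl
  have e₂ : {u : ℕ → E | colourCount c n u = m} = (fun u (i : Finset.range n) ↦ c (u i)) ⁻¹'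
      {v | (fun k ↦ (Finset.univ.filter fun i ↦ v i = k).card) = m} := by
    ext u
    have : colourCount c n u = fun k ↦
        (Finset.univ.filter fun i : Finset.range n ↦ c (u i) = k).card := by
      ext k
      rw [colourCount, Finset.univ_eq_attach, Finset.filter_attach (fun i ↦ c (u i) = k),
        Finset.card_map, Finset.card_attach]
    simp [this]
  have e₃ : Measure.infinitePi (fun _ : ℕ ↦ q) {u | c (u n) = j} = q (c ⁻¹' {j}) := by
    have := Measure.infinitePi_map_eval (fun _ : ℕ ↦ q) n
    conv_rhs => rw [← this, Measure.map_apply (measurable_pi_apply n)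
      (hc (measurableSet_singleton j))]
    rfl
  rw [e₂, e₁, h₂, ← e₁, e₃]

/-- This is the multinomial law, cleared of denominators. The induction conditions on the colour `j`
of the last point: removing it splits a factor `m j` off the factorials, and these factors sum to `n
+ 1`. -/
theorem prod_factorial_mul_measure_colourCount (hc : Measurable c) (n : ℕ) (m : κ → ℕ) :
    (∏ j, ((m j).factorial : ℝ≥0∞)) *
        Measure.infinitePi (fun _ : ℕ ↦ q) {u | colourCount c n u = m} =
      if ∑ j, m j = n then (n.factorial : ℝ≥0∞) * ∏ j, q (c ⁻¹' {j}) ^ m j else 0 := by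
  induction n generalizing m with
  | zero =>
    have h0 (u : ℕ → E) : colourCount c 0 u = 0 := by ext; simp [colourCount]
    by_cases hm : m = 0
    · subst hm; simp [h0]
    · have hs : ∑ j, m j ≠ 0 := fun h ↦ hm (by ext j; simpa using (Finset.sum_eq_zero_iff.1 h) j)
      have he : {u : ℕ → E | colourCount c 0 u = m} = ∅ := by
        ext u; simpa [h0] using Ne.symm hm
      rw [he, if_neg hs]; simp
  | succ n ih =>
    set m' : κ → κ → ℕ := fun j ↦ Function.update m j (m j - 1) with hm'
    have hset : {u : ℕ → E | colourCount c (n + 1) u = m} = ⋃ j ∈ Finset.univ.filter (m · ≠ 0),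
        ({u | c (u n) = j} ∩ {u | colourCount c n u = m' j}) := by
      ext u
      rw [Set.mem_ofPred_eq, colourCount_succ_eq_iff]
      simp [hm']
    have hoff (j i : κ) (hi : i ∈ Finset.univ.erase j) : m' j i = m i := by
      simp [hm', (Finset.mem_erase.1 hi).1]
    have hon (j : κ) : m' j j = m j - 1 := by simp [hm']
    have hterm (j : κ) (hj : m j ≠ 0) : (∏ i, ((m i).factorial : ℝ≥0∞)) *
        (q (c ⁻¹' {j}) * Measure.infinitePi (fun _ : ℕ ↦ q) {u | colourCount c n u = m' j}) =
        m j * if ∑ j, m j = n + 1 then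
          (n.factorial : ℝ≥0∞) * ∏ j, q (c ⁻¹' {j}) ^ m j else 0 := by
      have h₁ : ∏ i, ((m i).factorial : ℝ≥0∞) = m j * ∏ i, ((m' j i).factorial : ℝ≥0∞) := by
        rw [← Finset.mul_prod_erase _ _ (Finset.mem_univ j),
          ← Finset.mul_prod_erase (f := fun i ↦ ((m' j i).factorial : ℝ≥0∞)) _
            (Finset.mem_univ j), ← mul_assoc, hon]
        congr 1
        · exact_mod_cast (Nat.mul_factorial_pred hj).symm
        · exact Finset.prod_congr rfl fun i hi ↦ by rw [hoff j i hi]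
      have h₂ : ∏ i, q (c ⁻¹' {i}) ^ m i
          = q (c ⁻¹' {j}) * ∏ i, q (c ⁻¹' {i}) ^ m' j i := by
        rw [← Finset.mul_prod_erase _ _ (Finset.mem_univ j),
          ← Finset.mul_prod_erase (f := fun i ↦ q (c ⁻¹' {i}) ^ m' j i) _
            (Finset.mem_univ j), ← mul_assoc, hon]
        congr 1
        · exact (mul_pow_sub_one hj _).symm
        · exact Finset.prod_congr rfl fun i hi ↦ by rw [hoff j i hi]
      have h₃ : ∑ i, m i = (∑ i, m' j i) + 1 := by
        rw [← Finset.add_sum_erase _ _ (Finset.mem_univ j),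
          ← Finset.add_sum_erase (f := m' j) _ (Finset.mem_univ j), hon,
          Finset.sum_congr rfl fun i hi ↦ hoff j i hi]
        have := Nat.sub_add_cancel (Nat.one_le_iff_ne_zero.2 hj)
        linarith
      rw [h₁, show ∀ a b d e : ℝ≥0∞, a * b * (d * e) = a * (d * (b * e)) by intros; ring, ih, h₂,
        h₃]
      simp only [add_left_inj]
      split_ifs
      · ring
      · simp
    rw [hset, measure_biUnion_finset (fun i _ j _ hij ↦ ?_) fun j _ ↦ ?_, Finset.mul_sum]
    · simp_rw [measure_colour_inter_colourCount q hc]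
      rw [Finset.sum_congr rfl fun j hj ↦ hterm j (Finset.mem_filter.1 hj).2, ← Finset.sum_mul,
        Finset.sum_filter_of_ne (fun j _ h ↦ by exact_mod_cast h), ← Nat.cast_sum]
      split_ifs with h
      · rw [h, ← mul_assoc, Nat.factorial_succ]; push_cast; rfl
      · simp
    · exact Set.disjoint_left.2 fun u hu hu' ↦ hij (hu.1.symm.trans hu'.1)
    · exact (hc.comp (measurable_pi_apply n) (measurableSet_singleton j)).inter
        (measurable_colourCount hc n (measurableSet_singleton _))

/-- **Poisson thinning**: if a Poisson number of independent points is coloured, then the numbers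
of the points of each colour are independent Poisson variables. -/
theorem hasLaw_colourCount (hc : Measurable c) (r : ℝ≥0) :
    HasLaw (fun (ω : ℕ × (ℕ → E)) ↦ colourCount c ω.1 ω.2)
      (Measure.pi fun j ↦ poissonMeasure ((q (c ⁻¹' {j})).toNNReal * r))
      ((poissonMeasure r).prod (Measure.infinitePi fun _ : ℕ ↦ q)) := by
  have hm : Measurable fun (ω : ℕ × (ℕ → E)) ↦ colourCount c ω.1 ω.2 :=
    measurable_from_prod_countable_right fun n ↦ measurable_colourCount hc n
  refine ⟨hm.aemeasurable, Measure.ext_of_singleton fun m ↦ ?_⟩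
  have hsum : ∑ j, (q (c ⁻¹' {j})).toReal = 1 := by
    have : ∑ j, q (c ⁻¹' {j}) = 1 := by
      rw [← measure_biUnion_finset (fun i _ j _ h ↦ Disjoint.preimage _ (by simpa using h))
        fun j _ ↦ hc (measurableSet_singleton j)]
      convert measure_univ (μ := q)
      ext; simp
    have h := congrArg ENNReal.toReal this
    rwa [ENNReal.toReal_sum fun _ _ ↦ measure_ne_top _ _] at h
  have hpt (n : ℕ) (hn : n ≠ ∑ j, m j) :
      Measure.infinitePi (fun _ : ℕ ↦ q) {u | colourCount c n u = m} = 0 := by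
    have := prod_factorial_mul_measure_colourCount q hc n m
    rw [if_neg (Ne.symm hn), mul_eq_zero, Finset.prod_eq_zero_iff] at this
    refine this.resolve_left ?_
    rintro ⟨j, -, hj⟩
    exact Nat.factorial_ne_zero _ (by exact_mod_cast hj)
  rw [Measure.map_apply hm (measurableSet_singleton m),
    Measure.prod_apply (hm (measurableSet_singleton m)), lintegral_countable']
  -- The colour counts determine the number of points, so one term of the Poisson mixture remains.
  rw [tsum_eq_single (∑ j, m j) fun n hn ↦ by
    rw [show Prod.mk n ⁻¹' _ = {u | colourCount c n u = m} from rfl, hpt n hn, zero_mul]]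
  change Measure.infinitePi (fun _ : ℕ ↦ q) {u | colourCount c (∑ j, m j) u = m} * _ = _
  have hmain := prod_factorial_mul_measure_colourCount q hc (∑ j, m j) m
  rw [if_pos rfl] at hmain
  set w := Measure.infinitePi (fun _ : ℕ ↦ q) {u | colourCount c (∑ j, m j) u = m}
  have hw : w ≠ ∞ := measure_ne_top _ _
  have hreal : (∏ j, ((m j).factorial : ℝ)) * w.toReal =
      ((∑ j, m j).factorial : ℝ) * ∏ j, (q (c ⁻¹' {j})).toReal ^ m j := by
    have := congrArg ENNReal.toReal hmain
    simpa [ENNReal.toReal_mul, ENNReal.toReal_prod] using this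
  rw [Measure.pi_singleton, ← ENNReal.ofReal_toReal hw]
  simp_rw [poissonMeasure_singleton]
  rw [← ENNReal.ofReal_mul (by positivity), ← ENNReal.ofReal_prod_of_nonneg fun _ _ ↦ by positivity]
  congr 1
  have hf : (∏ j, ((m j).factorial : ℝ)) ≠ 0 := by positivity
  have hf' : ((∑ j, m j).factorial : ℝ) ≠ 0 := by positivity
  rw [Finset.prod_div_distrib, Finset.prod_mul_distrib, ← Real.exp_sum, eq_div_iff hf]
  push_cast
  simp_rw [mul_pow]
  rw [Finset.sum_neg_distrib, ← Finset.sum_mul, hsum, one_mul, Finset.prod_mul_distrib,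
    Finset.prod_pow_eq_pow_sum]
  rw [show ∀ a b d : ℝ, a * b * d = (d * a) * b by intros; ring, hreal]
  field_simp

end PoissonCounts

/-! ### Counts of points in disjoint sets -/

section PointCounts

variable {E ι : Type*} [MeasurableSpace E] [Fintype ι]

/-- The number of the first `n` points of the sequence `u` that lie in `A`. -/
noncomputable def pointCount (A : Set E) (n : ℕ) (u : ℕ → E) : ℕ :=
  ∑ i ∈ Finset.range n, A.indicator 1 (u i)

/-- The numbers of the points of a Poisson point process in disjoint sets are independent Poisson
variables. -/
theorem hasLaw_pointCount (q : Measure E) [IsProbabilityMeasure q] {A : ι → Set E}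
    (hA : ∀ i, MeasurableSet (A i)) (hd : Pairwise fun i j ↦ Disjoint (A i) (A j)) (r : ℝ≥0) :
    HasLaw (fun (ω : ℕ × (ℕ → E)) i ↦ pointCount (A i) ω.1 ω.2)
      (Measure.pi fun i ↦ poissonMeasure ((q (A i)).toNNReal * r))
      ((poissonMeasure r).prod (Measure.infinitePi fun _ : ℕ ↦ q)) := by
  classical
  let : MeasurableSpace (Option ι) := ⊤
  -- A point is coloured by the set containing it, unique by disjointness, or by `none` outside all
  -- of them.
  let c : E → Option ι := fun u ↦ if h : ∃ i, u ∈ A i then some h.choose else none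
  have hc_some (u : E) (i : ι) : c u = some i ↔ u ∈ A i := by
    constructor
    · intro h
      by_cases hu : ∃ i, u ∈ A i
      · simp only [c, dif_pos hu, Option.some.injEq] at h
        exact h ▸ hu.choose_spec
      · simp [c, dif_neg hu] at h
    · intro h
      have hu : ∃ i, u ∈ A i := ⟨i, h⟩
      simp only [c, dif_pos hu, Option.some.injEq]
      by_contra hne
      exact Set.disjoint_left.1 (hd hne) hu.choose_spec h
  have hpre (i : ι) : c ⁻¹' {some i} = A i := by ext u; exact hc_some u i
  have hc : Measurable c := by
    refine measurable_to_countable' fun o ↦ ?_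
    cases o with
    | some i => rw [hpre]; exact hA i
    | none =>
      have : c ⁻¹' {none} = (⋃ i, A i)ᶜ := by
        ext u
        simp [c]
      rw [this]
      exact (MeasurableSet.iUnion hA).compl
  have h := hasLaw_colourCount q hc r
  have h' := (iIndepFun_eval_pi fun o ↦ (q (c ⁻¹' {o})).toNNReal * r).precomp
    (Option.some_injective ι) |>.hasLaw_pi (fun i ↦ hasLaw_eval_pi _ (some i))
  have h₂ := h'.fun_comp h
  simp_rw [hpre] at h₂
  convert h₂ using 3 with ω i
  simp only [pointCount, colourCount, hc_some, Finset.card_filter, Set.indicator_apply,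
    Pi.one_apply]

end PointCounts

/-! ### Construction of the Poisson process -/

section PoissonPath

variable {T : ℝ≥0}

/-- The counting path of the first `n` points of the sequence `u`. -/
noncomputable def countingPath (n : ℕ) (u : ℕ → Time T) : CountingPath T :=
  -- The interval is open at 0, so the path vanishes there even if a point falls at 0.
  ⟨fun t ↦ pointCount (Set.Ioc (Time.start T) t) n u, by simp [pointCount], fun s t hst ↦
    Finset.sum_le_sum fun i _ ↦ Set.indicator_le_indicator_of_subset
      (Set.Ioc_subset_Ioc_right hst) (fun _ ↦ Nat.zero_le _) _, fun t ↦ by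
    -- Right continuity: each indicator is constant on a right neighbourhood of `t`.
    refine tendsto_finsetSum _ fun i _ ↦ tendsto_nhds_of_eventually_eq ?_
    by_cases hi : u i ≤ t
    · filter_upwards [self_mem_nhdsWithin] with s hs
      have hs' : u i ≤ s := hi.trans hs
      simp [Set.indicator_apply, hi, hs']
    · filter_upwards [mem_nhdsWithin_of_mem_nhds (Iio_mem_nhds (not_le.1 hi))] with s hs
      have hs' : ¬ u i ≤ s := not_le.2 hs
      simp [hi, hs']⟩

theorem countingPath_sub (n : ℕ) (u : ℕ → Time T) {s t : Time T} (hst : s ≤ t) :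
    (countingPath n u).1 t - (countingPath n u).1 s = pointCount (Set.Ioc s t) n u := by
  rw [Nat.sub_eq_iff_eq_add' ((countingPath n u).2.2.1 hst)]
  simp only [countingPath, pointCount]
  rw [← Finset.sum_add_distrib]
  refine Finset.sum_congr rfl fun i _ ↦ ?_
  have h0 : Time.start T ≤ s := s.2.1
  rw [← Set.Ioc_union_Ioc_eq_Ioc h0 hst, Set.indicator_union_of_disjoint]
  exact Set.disjoint_left.2 fun _ h h' ↦ h'.1.not_ge h.2

theorem measurable_countingPath :
    Measurable fun ω : ℕ × (ℕ → Time T) ↦ countingPath ω.1 ω.2 := by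
  refine measurable_from_prod_countable_right fun n ↦ ?_
  refine Measurable.subtype_mk (measurable_pi_lambda _ fun t ↦ ?_)
  have h : Measurable ((Set.Ioc (Time.start T) t).indicator (1 : Time T → ℕ)) :=
    measurable_one.indicator measurableSet_Ioc
  exact Finset.measurable_fun_sum (Finset.range n) fun i _ ↦ h.comp (measurable_pi_apply i)

/-- The uniform distribution on `[0, T]`. -/
noncomputable def uniformTime (T : ℝ≥0) : Measure (Time T) := (T : ℝ≥0∞)⁻¹ • timeVolume T

theorem isProbabilityMeasure_uniformTime (hT : 0 < T) : IsProbabilityMeasure (uniformTime T) :=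
  ⟨by simp [uniformTime, timeVolume_univ, ENNReal.inv_mul_cancel, hT.ne']⟩

theorem uniformTime_mul (hT : 0 < T) (A : Set (Time T)) (r : ℝ≥0) :
    (uniformTime T A).toNNReal * (r * T) = r * (timeVolume T A).toNNReal := by
  have : T ≠ 0 := hT.ne'
  simp only [uniformTime, Measure.smul_apply, smul_eq_mul, ENNReal.toNNReal_mul,
    ENNReal.toNNReal_inv, ENNReal.toNNReal_coe]
  field_simp

/-- The law of a Poisson process on `[0, T]` with constant intensity `r`. -/
noncomputable def poissonPathLaw (T r : ℝ≥0) : Measure (CountingPath T) :=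
  ((poissonMeasure (r * T)).prod (Measure.infinitePi fun _ : ℕ ↦ uniformTime T)).map
    fun ω ↦ countingPath ω.1 ω.2

theorem isProbabilityMeasure_poissonPathLaw (hT : 0 < T) (r : ℝ≥0) :
    IsProbabilityMeasure (poissonPathLaw T r) := by
  have := isProbabilityMeasure_uniformTime hT
  exact Measure.isProbabilityMeasure_map measurable_countingPath.aemeasurable

theorem hasLaw_increments_poissonPathLaw (hT : 0 < T) (r : ℝ≥0) {n : ℕ} {t : Fin (n + 1) → Time T}
    (ht : Monotone t) :
    HasLaw (fun (w : CountingPath T) (j : Fin n) ↦ w.1 (t j.succ) - w.1 (t j.castSucc))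
      (Measure.pi fun j : Fin n ↦ poissonMeasure
        (r * (timeVolume T (Set.Ioc (t j.castSucc) (t j.succ))).toNNReal))
      (poissonPathLaw T r) := by
  have := isProbabilityMeasure_uniformTime hT
  have hm : Measurable fun (w : CountingPath T) (j : Fin n) ↦
      w.1 (t j.succ) - w.1 (t j.castSucc) :=
    measurable_pi_lambda _ fun _ ↦
      measurable_nat_sub (measurable_path_eval _) (measurable_path_eval _)
  refine ⟨hm.aemeasurable, ?_⟩
  rw [poissonPathLaw, Measure.map_map hm measurable_countingPath]
  have h := (hasLaw_pointCount (uniformTime T)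
    (A := fun j : Fin n ↦ Set.Ioc (t j.castSucc) (t j.succ)) (fun _ ↦ measurableSet_Ioc)
    (fun i j hij ↦ ?_) (r * T)).map_eq
  · simp_rw [uniformTime_mul hT] at h
    rw [← h]
    congr 1
    ext ω j
    exact countingPath_sub _ _ (ht j.castSucc_lt_succ.le)
  · refine Set.disjoint_left.2 fun τ hp hq ↦ ?_
    rcases lt_or_gt_of_ne hij with hlt | hlt
    · exact absurd (hp.2.trans (ht (Fin.le_castSucc_iff.2 (by simpa using hlt)))) hq.1.not_ge
    · exact absurd (hq.2.trans (ht (Fin.le_castSucc_iff.2 (by simpa using hlt)))) hp.1.not_ge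

end PoissonPath

/-! ### Achievability with each message in its own band -/

section ConstantInput

variable {L : ℕ∞} {T : ℝ≥0}

open Classical in
/-- The output law of the channel for the constant input `b`. -/
noncomputable def constOutputLaw (α T : ℝ≥0) (b : Band L) : Measure (Output L T) :=
  Measure.infinitePi fun i ↦ poissonPathLaw T (if b = i then α else 1)

theorem setIntegral_intensity_const (α : ℝ≥0) (b i : Band L) [Decidable (b = i)]
    (s : Set (Time T)) :
    (∫ τ in s, intensity α (fun _ ↦ b) i τ ∂timeVolume T).toNNReal =
      (if b = i then α else 1) * (timeVolume T s).toNNReal := by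
  have h : ∀ τ : Time T, intensity α (fun _ ↦ b) i τ = ((if b = i then α else 1 : ℝ≥0) : ℝ) := by
    intro τ
    by_cases h : b = i <;> simp [intensity, h]
  simp_rw [h]
  rw [integral_const, ← NNReal.coe_inj, Real.coe_toNNReal _ (by positivity)]
  push_cast
  rw [smul_eq_mul, mul_comm, measureReal_restrict_apply_univ]
  rfl

/-- `Code.HasErrorProb` asks for output laws to exist, so attaining the bound requires constructing
them. -/
theorem isOutputLaw_constOutputLaw (hT : 0 < T) (α : ℝ≥0) (b : Band L) :
    IsOutputLaw α (fun _ ↦ b) (constOutputLaw α T b) := by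
  classical
  have hprob := isProbabilityMeasure_poissonPathLaw hT
  have heval (i : Band L) : HasLaw (fun y : Output L T ↦ y i)
      (poissonPathLaw T (if b = i then α else 1)) (constOutputLaw α T b) := by
    convert (measurePreserving_eval_infinitePi
      (fun i ↦ poissonPathLaw T (if b = i then α else 1)) i).hasLaw
    simp [constOutputLaw]
  have hincr (i : Band L) {n : ℕ} {t : Fin (n + 1) → Time T} (ht : Monotone t) :=
    (hasLaw_increments_poissonPathLaw hT (if b = i then α else 1) ht).fun_comp (heval i)
  have hcoord (i : Band L) {n : ℕ} {t : Fin (n + 1) → Time T} (ht : Monotone t) (j : Fin n) :=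
    (hasLaw_eval_pi _ j).fun_comp (hincr i ht)
  have hP : IsProbabilityMeasure (constOutputLaw α T b) := by
    unfold constOutputLaw; infer_instance
  refine ⟨hP, iIndepFun_infinitePi (X := fun _ w ↦ w) fun _ ↦ measurable_id, ?_, ?_⟩
  · intro i n t ht
    exact (iIndepFun_iff_hasLaw_pi_pi (hcoord i ht)).2 (hincr i ht)
  · intro i s t hst
    rw [setIntegral_intensity_const]
    have hm : Monotone (![s, t] : Fin (1 + 1) → Time T) := by
      refine Fin.monotone_iff_le_succ.2 fun j ↦ ?_
      rw [Subsingleton.elim j 0]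
      exact hst.le
    exact hcoord i hm 0

/-- The time `T`, as a point of `[0, T]`. -/
def Time.final (T : ℝ≥0) : Time T := ⟨T, T.2, le_refl _⟩

/-- A final count is the increment over all of `[0, T]`, and injectivity of `f` makes the counts
independent. This reduces the code to the discrete model. -/
theorem hasLaw_finalCounts (hT : 0 < T) {α : ℝ≥0} {M : ℕ} {f : Fin M → Band L}
    (hf : Function.Injective f) {k : Fin M} {P : Measure (Output L T)}
    (hP : IsOutputLaw α (fun _ ↦ f k) P) :
    HasLaw (fun (y : Output L T) j ↦ (y (f j)).1 (Time.final T))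
      (Measure.pi fun j ↦ poissonMeasure ((if j = k then α else 1) * T)) P := by
  classical
  refine iIndepFun.hasLaw_pi (fun j ↦ ?_) ((hP.indep_bands.precomp hf).comp
    (fun _ (w : CountingPath T) ↦ w.1 (Time.final T)) fun _ ↦ measurable_path_eval _)
  have h := hP.law_increment (f j) (Time.start T) (Time.final T) (by
    exact Subtype.mk_lt_mk.2 (by exact_mod_cast hT))
  rw [setIntegral_intensity_const] at h
  have hv : (timeVolume T (Set.Ioc (Time.start T) (Time.final T))).toNNReal = T := by
    have : Subtype.val '' (Set.Ioc (Time.start T) (Time.final T)) = Set.Ioc (0 : ℝ) T := by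
      ext s
      constructor
      · rintro ⟨u, hu, rfl⟩
        exact hu
      · intro hs
        exact ⟨⟨s, hs.1.le, hs.2⟩, hs, rfl⟩
    rw [timeVolume_apply, this, Real.volume_Ioc]
    simp
  rw [hv] at h
  convert h using 2 with y
  · simp [(y (f j)).2.1]
  · simp [hf.eq_iff, eq_comm]

/-- For each message in its own band, some decoder attains the bound. -/
theorem exists_code_hasErrorProb (hT : 0 < T) (α : ℝ≥0) {M : ℕ} [NeZero M] {f : Fin M → Band L}
    (hf : Function.Injective f) :
    ∃ c : Code L T M, (∀ k t, c.enc k t = f k) ∧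
      c.HasErrorProb α (1 - (optimalScore α T M).toReal / M) := by
  obtain ⟨d, hd⟩ := exists_optimal_decoder (M := M) α
  have hm : Measurable fun (y : Output L T) j ↦ (y (f j)).1 (Time.final T) :=
    measurable_pi_lambda _ fun _ ↦ measurable_eval _ _
  let c : Code L T M :=
    { enc := fun k _ ↦ f k
      measurable_enc := fun _ ↦ measurable_const
      dec := fun y ↦ d fun j ↦ (y (f j)).1 (Time.final T)
      measurable_dec := Measurable.of_discrete.comp hm }
  refine ⟨c, fun _ _ ↦ rfl, fun k ↦ constOutputLaw α T (f k),
    fun k ↦ isOutputLaw_constOutputLaw hT α (f k), ?_⟩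
  have hP (k : Fin M) := isOutputLaw_constOutputLaw hT α (f k)
  have := fun k ↦ (hP k).isProbabilityMeasure
  have hM0 : (M : ℝ) ≠ 0 := by exact_mod_cast NeZero.ne M
  have herr (k : Fin M) : (constOutputLaw α T (f k)).real {y | c.dec y ≠ k} =
      1 - ((Measure.pi fun j ↦ poissonMeasure ((if j = k then α else 1) * T))
        {z | d z = k}).toReal := by
    rw [← (hasLaw_finalCounts hT hf (hP k)).map_eq, Measure.map_apply hm .of_discrete]
    exact probReal_compl_eq_one_sub (c.measurable_dec (measurableSet_singleton k))
  simp_rw [herr]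
  rw [Finset.sum_sub_distrib, ← ENNReal.toReal_sum fun _ _ ↦ measure_ne_top _ _,
    sum_pi_poissonMeasure_decoder α T d hd]
  simp [sub_div, hM0]

end ConstantInput

/-! ### Uniform guessing among the extremal counts -/

section Guess

variable {M : ℕ}

theorem pi_poissonMeasure_ite (α T : ℝ≥0) (k : Fin M) :
    Measure.pi (fun j ↦ poissonMeasure ((if j = k then α else 1) * T)) =
      (Measure.pi fun _ : Fin M ↦ poissonMeasure T).withDensity fun z ↦
        ENNReal.ofReal (Real.exp ((1 - α) * T)) * (α : ℝ≥0∞) ^ z k := by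
  refine Measure.ext fun A hA ↦ ?_
  have hk : ({j | j = k} : Finset (Fin M)) = {k} := by ext; simp
  rw [pi_poissonMeasure_ite_apply α (fun _ ↦ T), withDensity_apply _ hA,
    lintegral_const_mul _ .of_discrete, hk]
  simp

theorem uniformOn_preimage_singleton (σ : Equiv.Perm (Fin M)) (A : Set (Fin M)) (k : Fin M) :
    uniformOn (σ ⁻¹' A) {k} = uniformOn A {σ k} := by
  have h (B : Set (Fin M)) : Measure.count (σ ⁻¹' B) = Measure.count B := by
    rw [Measure.count_apply .of_discrete, Measure.count_apply .of_discrete,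
      Set.encard_preimage_of_bijective σ.bijective]
  rw [uniformOn, uniformOn, cond_apply .of_discrete, cond_apply .of_discrete, h,
    ← h (A ∩ {σ k})]
  congr 2
  ext; simp

theorem measurePreserving_comp_perm (σ : Equiv.Perm (Fin M)) (T : ℝ≥0) :
    MeasurePreserving (fun z : Fin M → ℕ ↦ z ∘ σ) (Measure.pi fun _ ↦ poissonMeasure T)
      (Measure.pi fun _ ↦ poissonMeasure T) :=
  ⟨.of_discrete, by
    have h := iIndepFun.hasLaw_pi (X := fun i (z : Fin M → ℕ) ↦ z (σ i))
      (fun i ↦ hasLaw_eval_pi (fun _ : Fin M ↦ T) (σ i))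
      ((iIndepFun_eval_pi fun _ : Fin M ↦ T).precomp σ.injective)
    exact h.map_eq⟩

variable [NeZero M]

/-- A guess that is uniformly distributed over a set `S z` of maximizers of `α ^ z k` that does not
depend on the numbering of the messages is correct with the optimal probability. -/
theorem guessLaw_real_ne_zero (α T : ℝ≥0) (S : (Fin M → ℕ) → Set (Fin M))
    (hne : ∀ z, (S z).Nonempty)
    (hmax : ∀ z, ∀ k ∈ S z, ∀ j, (α : ℝ≥0∞) ^ z j ≤ (α : ℝ≥0∞) ^ z k)
    (hperm : ∀ z (σ : Equiv.Perm (Fin M)), S (z ∘ σ) = σ ⁻¹' S z) :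
    (guessLaw α T M S).real {k | k ≠ 0} = 1 - (optimalScore α T M).toReal / M := by
  set Q : Measure (Fin M → ℕ) := Measure.pi fun _ ↦ poissonMeasure T with hQ
  have hcount : countLaw α T M =
      Measure.pi (fun j ↦ poissonMeasure ((if j = 0 then α else 1) * T)) := by
    unfold countLaw
    congr! 2 with i
    split_ifs <;> simp
  have hprob : ∀ z, IsProbabilityMeasure (uniformOn (S z)) := fun z ↦
    isProbabilityMeasure_uniformOn (Set.toFinite _) (hne z)
  have : IsProbabilityMeasure (countLaw α T M) := by rw [hcount]; infer_instance
  have hbind (A : Set (Fin M)) : guessLaw α T M S A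
      = ∫⁻ z, uniformOn (S z) A ∂countLaw α T M :=
    Measure.bind_apply .of_discrete Measurable.of_discrete.aemeasurable
  have : IsProbabilityMeasure (guessLaw α T M S) := ⟨by simp [hbind]⟩
  -- Swapping the messages 0 and `k` preserves `Q` and is respected by `S`, so all messages are
  -- guessed correctly with the same probability.
  have hsym (k : Fin M) : ∫⁻ z, (α : ℝ≥0∞) ^ z k * uniformOn (S z) {k} ∂Q
      = ∫⁻ z, (α : ℝ≥0∞) ^ z 0 * uniformOn (S z) {0} ∂Q := by
    rw [← (measurePreserving_comp_perm (Equiv.swap 0 k) T).lintegral_comp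
      (f := fun z ↦ (α : ℝ≥0∞) ^ z 0 * uniformOn (S z) {0}) .of_discrete]
    refine lintegral_congr fun z ↦ ?_
    rw [hperm, uniformOn_preimage_singleton]
    simp
  have hzero : guessLaw α T M S {0} = ENNReal.ofReal (Real.exp ((1 - α) * T)) *
      ∫⁻ z, (α : ℝ≥0∞) ^ z 0 * uniformOn (S z) {0} ∂Q := by
    rw [hbind, hcount, pi_poissonMeasure_ite, lintegral_withDensity_eq_lintegral_mul _ .of_discrete
      .of_discrete, ← lintegral_const_mul _ .of_discrete]
    refine lintegral_congr fun z ↦ ?_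
    simp [mul_assoc]
  have hscore : M * guessLaw α T M S {0} = optimalScore α T M := by
    calc M * guessLaw α T M S {0} = ENNReal.ofReal (Real.exp ((1 - α) * T)) *
          ∑ k : Fin M, ∫⁻ z, (α : ℝ≥0∞) ^ z k * uniformOn (S z) {k} ∂Q := by
          simp_rw [hsym, hzero]
          simp only [Finset.sum_const, Finset.card_univ, Fintype.card_fin, nsmul_eq_mul]
          ring
      _ = optimalScore α T M := by
          rw [← lintegral_finsetSum _ fun _ _ ↦ .of_discrete, optimalScore]
          congr 1
          refine lintegral_congr fun z ↦ ?_
          have hs : ∑ k, uniformOn (S z) {k} = 1 := by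
            rw [sum_measure_singleton, Finset.coe_univ, measure_univ]
          rw [← mul_one (⨆ k, (α : ℝ≥0∞) ^ z k), ← hs, Finset.mul_sum]
          refine Finset.sum_congr rfl fun k _ ↦ ?_
          -- The guess charges only maximizers, where the likelihood equals the supremum.
          by_cases hk : k ∈ S z
          · congr 1
            exact le_antisymm (le_iSup (fun k ↦ (α : ℝ≥0∞) ^ z k) k) (iSup_le (hmax z k hk))
          · have : uniformOn (S z) {k} = 0 := by
              rw [uniformOn_eq_zero_iff (Set.toFinite _)]
              simpa using hk
            simp [this]
  have hM0 : (M : ℝ) ≠ 0 := by exact_mod_cast NeZero.ne M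
  have hcompl : (guessLaw α T M S).real {k | k ≠ 0} = 1 - (guessLaw α T M S).real {0} :=
    probReal_compl_eq_one_sub (measurableSet_singleton 0)
  rw [hcompl, ← hscore, ENNReal.toReal_mul, ENNReal.toReal_natCast, mul_div_cancel_left₀ _ hM0]
  rfl

theorem argminSet_nonempty (z : Fin M → ℕ) : (argminSet z).Nonempty := Finite.exists_min z

theorem argmaxSet_nonempty (z : Fin M → ℕ) : (argmaxSet z).Nonempty := Finite.exists_max z

/-- It suffices that minimizers of the count maximize the likelihood. The converse can fail:
positive counts tie for `α = 0`, and all counts tie for `α = 1`. -/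
theorem guessLaw_argminSet {α : ℝ≥0} (hα : α ≤ 1) (T : ℝ≥0) :
    (guessLaw α T M argminSet).real {k | k ≠ 0} = 1 - (optimalScore α T M).toReal / M :=
  guessLaw_real_ne_zero α T _ argminSet_nonempty
    (fun _ _ hk j ↦ pow_le_pow_right_of_le_one' (mod_cast hα) (hk j))
    fun z σ ↦ by ext k; exact σ.surjective.forall (p := fun j ↦ z (σ k) ≤ z j).symm

theorem guessLaw_argmaxSet {α : ℝ≥0} (hα : 1 ≤ α) (T : ℝ≥0) :
    (guessLaw α T M argmaxSet).real {k | k ≠ 0} = 1 - (optimalScore α T M).toReal / M :=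
  guessLaw_real_ne_zero α T _ argmaxSet_nonempty
    (fun _ _ hk j ↦ pow_le_pow_right' (mod_cast hα) (hk j))
    fun z σ ↦ by ext k; exact σ.surjective.forall (p := fun j ↦ z j ≤ z (σ k)).symm

end Guess

/-! ### The perfect channel and the conclusion -/

theorem optimalScore_zero_toReal (T : ℝ≥0) (M : ℕ) :
    (optimalScore 0 T M).toReal = Real.exp T * (1 - (1 - Real.exp (-T)) ^ M) := by
  -- As `0 ^ 0 = 1`, the supremum indicates that some count vanishes; the complement is a product
  -- event.
  have h (z : Fin M → ℕ) : ⨆ k : Fin M, ((0 : ℝ≥0) : ℝ≥0∞) ^ z k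
      = (Set.univ.pi fun _ : Fin M ↦ ({0}ᶜ : Set ℕ))ᶜ.indicator 1 z := by
    by_cases hz : ∃ k, z k = 0
    · obtain ⟨k, hk⟩ := hz
      rw [Set.indicator_of_mem (by simpa using ⟨k, hk⟩)]
      refine le_antisymm (iSup_le fun j ↦ pow_le_one' (by simp) _) ?_
      exact le_iSup_of_le k (by simp [hk])
    · rw [Set.indicator_of_notMem (by simpa using hz)]
      push Not at hz
      simp [hz]
  rw [optimalScore, ENNReal.toReal_mul, ENNReal.toReal_ofReal (Real.exp_pos _).le]
  simp_rw [h]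
  rw [lintegral_indicator_one .of_discrete, ← measureReal_def, probReal_compl_eq_one_sub
    .of_discrete, measureReal_def, Measure.pi_pi, ENNReal.toReal_prod]
  simp_rw [← measureReal_def, probReal_compl_eq_one_sub (measurableSet_singleton (0 : ℕ)),
    poissonMeasure_real_singleton]
  simp

theorem exists_injective_band {L : ℕ∞} {M : ℕ} (h : (M : ℕ∞) ≤ L) :
    ∃ f : Fin M → Band L, Function.Injective f :=
  ⟨fun k ↦ ⟨k, lt_of_lt_of_le (by exact_mod_cast k.2) h⟩, fun j k hjk ↦
    Fin.ext (Subtype.mk.inj hjk)⟩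

theorem optError_eq {L : ℕ∞} {T : ℝ≥0} (hT : 0 < T) (α : ℝ≥0) {M : ℕ} [NeZero M]
    (h : (M : ℕ∞) ≤ L) : optError L α T M = 1 - (optimalScore α T M).toReal / M := by
  obtain ⟨f, hf⟩ := exists_injective_band h
  obtain ⟨c, -, hc⟩ := exists_code_hasErrorProb hT α hf
  exact optError_eq_of_hasErrorProb hc

end OCPC

theorem theorem3 (M : ℕ) [NeZero M] (T : NNReal) (hT : 0 < T) :
    (∀ (L : ℕ∞) (α : NNReal), (M : ℕ∞) ≤ L →
      (α ≤ 1 → OCPC.optError L α T M =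
        (OCPC.guessLaw α T M OCPC.argminSet).real {k | k ≠ 0}) ∧
      (1 < α → OCPC.optError L α T M =
        (OCPC.guessLaw α T M OCPC.argmaxSet).real {k | k ≠ 0}) ∧
      (∀ f : Fin M → OCPC.Band L, Function.Injective f →
        ∃ c : OCPC.Code L T M, (∀ k t, c.enc k t = f k) ∧
          c.HasErrorProb α (OCPC.optError L α T M))) ∧
    OCPC.optError ⊤ 0 T M =
      1 - Real.exp T * (M : ℝ)⁻¹ * (1 - (1 - Real.exp (-T)) ^ M) := by
  refine ⟨fun L α hL ↦ ?_, ?_⟩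
  · rw [OCPC.optError_eq hT α hL]
    exact ⟨fun h ↦ (OCPC.guessLaw_argminSet h T).symm,
      fun h ↦ (OCPC.guessLaw_argmaxSet h.le T).symm,
      fun f hf ↦ OCPC.exists_code_hasErrorProb hT α hf⟩
  · rw [OCPC.optError_eq hT 0 le_top, OCPC.optimalScore_zero_toReal]
    ring
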